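/- Let $\Gamma$ be a finitely generated virtually abelian group (i.e. $\Gamma$ has an abelian subgroup of finite index), and let $\mu$ be a probability measure on $\Gamma$ with finite second moment, $\sum_{\gamma\in\Gamma}|\gamma|^2\mu(\gamma)<\infty$ for a word metric $|\cdot|$ on $\Gamma$, whose support generates $\Gamma$ as a semigroup ($\mu$ need not be aperiodic). Let $\mu_n=\mu^{*n}$ be the $n$-fold convolution power. For $\rho\in[0,1]$ let $\pi^\rho=\rho\,(\mu\times\mu)+(1-\rho)\,\mu_{\mathrm{diag}}$ on $\Gamma\times\Gamma$, where $\mu_{\mathrm{diag}}$ is the image of $\mu$ under $\gamma\mapsto(\gamma,\gamma)$, and let $\pi^\rho_n$ be its $n$-fold convolution power on the group $\Gamma\times\Gamma$. Write $\|\nu_1-\nu_2\|_{\mathrm{TV}}=\sup_{A}|\nu_1(A)-\nu_2(A)|$. Then $$\lim_{\rho\to1}\limsup_{n\to\infty}\|\pi^\rho_n-\mu_n\times\mu_n\|_{\mathrm{TV}}=0 .$$ If moreover $\Gamma$ admits a surjective homomorphism onto $\mathbb Z$, then $$\lim_{\rho\to0}\liminf_{n\to\infty}\|\pi^\rho_n-\mu_n\times\mu_n\|_{\mathrm{TV}}=1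 ;$$ in particular the $\mu$-random walk on $\Gamma$ is not noise sensitive in total variation, i.e. it is not true that $\lim_{n\to\infty}\|\pi^\rho_n-\mu_n\times\mu_n\|_{\mathrm{TV}}=0$ for every $\rho\in(0,1]$. -/

import Mathlib

open MeasureTheory Filter Topology
open scoped ENNReal

/-- A group is virtually abelian if it has an abelian subgroup of finite index. -/
def IsVirtuallyAbelian (Γ : Type*) [Group Γ] : Prop :=
  ∃ H : Subgroup Γ, H.FiniteIndex ∧ ∀ a ∈ H, ∀ b ∈ H, a * b = b * a

/-- The word length of `g` with respect to `S`: the least length of a word in the letters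
`S ∪ S⁻¹` that represents `g` (meaningful when `S` generates the group). -/
noncomputable def wordLength {Γ : Type*} [Group Γ] (S : Set Γ) (g : Γ) : ℕ :=
  sInf {n : ℕ | ∃ l : List Γ, l.length = n ∧ (∀ s ∈ l, s ∈ S ∨ s⁻¹ ∈ S) ∧ l.prod = g}

/-- `μ` has finite second moment: `∑ |g|² μ(g) < ∞` for the word length with respect to a
finite generating set.  Any two such word lengths are bi-Lipschitz equivalent, so the choice of
the generating set is immaterial. -/
def HasFiniteSecondMoment {Γ : Type*} [Group Γ] [MeasurableSpace Γ] (μ : Measure Γ) : Prop :=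
  ∃ S : Set Γ, S.Finite ∧ Subgroup.closure S = ⊤ ∧
    ∫⁻ g, (wordLength S g : ℝ≥0∞) ^ 2 ∂μ < ∞

/-- The set of atoms of `μ`; on a countable discrete group it is the support of `μ`. -/
def atoms {Γ : Type*} [MeasurableSpace Γ] (μ : Measure Γ) : Set Γ :=
  {g | μ {g} ≠ 0}

/-- The support of `μ` generates the group as a semigroup: every element is a product of
finitely many (at least one) elements of the support. -/
def SupportGenerates {Γ : Type*} [Group Γ] [MeasurableSpace Γ] (μ : Measure Γ) : Prop :=
  Subsemigroup.closure (atoms μ) = ⊤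

/-- The `n`-fold convolution power `μ_n`, i.e. the law at time `n` of the `μ`-random walk started
at the identity. -/
noncomputable def convPower {G : Type*} [Monoid G] [MeasurableSpace G] (μ : Measure G) :
    ℕ → Measure G
  | 0 => Measure.dirac 1
  | n + 1 => (convPower μ n).mconv μ

/-- The measure `π^ρ = ρ (μ × μ) + (1 - ρ) μ_diag` on `Γ × Γ`, for `ρ ∈ [0, 1]`. -/
noncomputable def noiseMeasure {Γ : Type*} [MeasurableSpace Γ] (μ : Measure Γ) (ρ : ℝ) :
    Measure (Γ × Γ) :=
  ENNReal.ofReal ρ • μ.prod μ + ENNReal.ofReal (1 - ρ) • μ.map (fun g => (g, g))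

/-- The total variation distance `sup_A |ν₁(A) - ν₂(A)|` of two finite measures. -/
noncomputable def tvDist {X : Type*} [MeasurableSpace X] (ν₁ ν₂ : Measure X) : ℝ :=
  ⨆ A : {A : Set X // MeasurableSet A}, |ν₁.real A - ν₂.real A|

/-- The distance `‖π^ρ_n - μ_n × μ_n‖_TV`. -/
noncomputable def noiseDist {Γ : Type*} [Group Γ] [MeasurableSpace Γ] (μ : Measure Γ) (ρ : ℝ)
    (n : ℕ) : ℝ :=
  tvDist (convPower (noiseMeasure μ ρ) n) ((convPower μ n).prod (convPower μ n))

/-- The `μ`-random walk is noise sensitive in total variation. -/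
def IsNoiseSensitive {Γ : Type*} [Group Γ] [MeasurableSpace Γ] (μ : Measure Γ) : Prop :=
  ∀ ρ ∈ Set.Ioc (0 : ℝ) 1, Tendsto (fun n => noiseDist μ ρ n) atTop (𝓝 0)

/-! Near `ρ = 1`. For a representation `T` of `Γ × Γ` by contractions in a Banach algebra, let `P`
and `H` be the averages of `T` over `π^ρ` and `μ × μ`. Convolution becomes multiplication, and `P -
H = (1 - ρ) D` with `D = noiseDiff T μ`. For right translation on bounded functions, the operator
norm of `P^n - H^n` dominates the total variation distance. In the telescoping sum of the terms `P^k
(P - H) H^j`, `k + j = n - 1`, it therefore suffices that `P^k D` is `O(1/k)` and `D H^j` is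
`O(1/j)`, uniformly in `ρ ≥ 1/2`: each of the `n` terms is then `O((1 - ρ)/n)`.

The rate `1/k` holds because `π^ρ` and `μ × μ` have the same marginals, so that `D` is an average of
second order differences `(1 - T(m,1)) (1 - T(1,n))` (`noiseDiff_eq`). Each first order factor costs
`1/√k`, as for a simple random walk on the integers. The directions `m = g h⁻¹` lie in the subgroup
`N` attached to the period of the walk. If `m`, `n` lie in a normal abelian subgroup `A ≤ N` of
finite index, the uniform law on a finite conjugation invariant set `F ⊆ A` averages to an operator
commuting with everything; splitting a multiple of it off a block of steps gives the bound
(`norm_avg_pow_mul_le_of_mem`). For general directions in `N`, a step has a fixed chance of being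
uniform on a transversal of `A` in `N`, which turns them into directions in `A`; otherwise it
conjugates them, and the second moment controls how much they lengthen. A recursion in `k` closes
the estimate (`exists_norm_avg_pow_mul_mixedDiff_le`). Inversion of the group gives the bound for `D
H^j`.

Near `ρ = 0`. Let `u` be a homomorphism onto the integers. Diagonal steps do not change `u(x) -
u(y)`, so its variance under `π^ρ_n` is `ρ v n`, whereas under `μ_n × μ_n` the same smoothing
estimate spreads it over scale `√n`. With `ρ = s⁴`, the event that it is at most about `s√n` in
absolute value separates the two laws. -/

set_option linter.unusedSectionVars false

/-! ### Smoothing by powers of contractions in a normed algebra -/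

section Smoothing

variable {𝔸 : Type*} [NormedRing 𝔸] [NormedAlgebra ℝ 𝔸]

/-- Coefficientwise, `(i+1) (C(i,m) - C(i,m-1)) = C(i+1,m) (i+1-2m)`. For a contraction `y` the norm
is thus governed by the first absolute moment of a centred binomial variable. -/
lemma one_add_pow_mul_one_sub (y : 𝔸) (i : ℕ) :
    ((i : ℝ) + 1) • ((1 + y) ^ i * (1 - y)) =
      ∑ m ∈ Finset.range (i + 2),
        (((i + 1).choose m : ℝ) * (((i + 1 : ℕ) : ℝ) - 2 * m)) • y ^ m := by
  have hpow : (1 + y) ^ i = ∑ m ∈ Finset.range (i + 1), (i.choose m : ℝ) • y ^ m := by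
    rw [add_comm, (Commute.one_right y).add_pow]
    refine Finset.sum_congr rfl fun m _ => ?_
    rw [one_pow, mul_one, ← (Nat.cast_commute _ _).eq, ← nsmul_eq_mul, Nat.cast_smul_eq_nsmul]
  have h1 : (1 + y) ^ i = ∑ m ∈ Finset.range (i + 2), (i.choose m : ℝ) • y ^ m := by
    rw [Finset.sum_range_succ, hpow]; simp
  have h2 : (1 + y) ^ i * y =
      ∑ m ∈ Finset.range (i + 2), (((i + 1).choose m : ℝ) - (i.choose m : ℝ)) • y ^ m := by
    rw [Finset.sum_range_succ', hpow, Finset.sum_mul]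
    simp only [Nat.choose_zero_right, sub_self, zero_smul, add_zero]
    refine Finset.sum_congr rfl fun m _ => ?_
    rw [Nat.choose_succ_succ, smul_mul_assoc, ← pow_succ]
    simp
  rw [mul_sub, mul_one, h2, h1, ← Finset.sum_sub_distrib, Finset.smul_sum]
  refine Finset.sum_congr rfl fun m hm => ?_
  rw [← sub_smul, smul_smul]
  congr 1
  have h3 : ((i + 1).choose m : ℝ) * (((i + 1 : ℕ) : ℝ) - m) = (i.choose m : ℝ) * (i + 1) := by
    have hm' : m ≤ i + 1 := Nat.lt_succ_iff.mp (Finset.mem_range.mp hm)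
    rw [← Nat.cast_sub hm']
    have := Nat.choose_mul_succ_eq i m
    exact_mod_cast this.symm
  push_cast at h3 ⊢
  linarith

variable [NormOneClass 𝔸]

/-- Binomial expansion of a power of a perturbed convex combination. -/
lemma norm_smul_add_pow_mul_le {b D x : 𝔸} {ε : ℝ} (hε : 0 ≤ ε) (hbD : Commute b D)
    (hD : ‖D‖ ≤ 1 - ε) {f : ℕ → ℝ} (hf : ∀ j, ‖b ^ j * x‖ ≤ f j) (k : ℕ) :
    ‖(ε • b + D) ^ k * x‖ ≤
      ∑ j ∈ Finset.range (k + 1), (k.choose j : ℝ) * (ε ^ j * (1 - ε) ^ (k - j)) * f j := by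
  rw [(hbD.smul_left ε).add_pow, Finset.sum_mul]
  refine (norm_sum_le _ _).trans (Finset.sum_le_sum fun j _ => ?_)
  have h1 : (ε • b) ^ j * D ^ (k - j) * (k.choose j : 𝔸) * x
      = ((k.choose j : ℝ) * ε ^ j) • (D ^ (k - j) * (b ^ j * x)) := by
    rw [smul_pow, (Nat.cast_commute (k.choose j) _).symm.eq, smul_mul_assoc,
      (hbD.pow_pow j (k - j)).eq, ← nsmul_eq_mul, ← Nat.cast_smul_eq_nsmul ℝ, smul_smul,
      smul_mul_assoc, mul_assoc]
  rw [h1, norm_smul, Real.norm_of_nonneg (by positivity), mul_assoc, mul_assoc, mul_assoc]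
  refine mul_le_mul_of_nonneg_left (mul_le_mul_of_nonneg_left ?_ (by positivity)) (by positivity)
  refine (norm_mul_le _ _).trans (mul_le_mul ?_ (hf j) (norm_nonneg _) ?_)
  · exact (norm_pow_le _ _).trans (pow_le_pow_left₀ (norm_nonneg _) hD _)
  · exact pow_nonneg ((norm_nonneg _).trans hD) _

/-- The mean of `1/(J+1)` for `J` binomial: `C(k,j)/(j+1) = C(k+1,j+1)/(k+1)` turns the sum into the
binomial expansion of order `k+1` without its zeroth term. -/
lemma sum_choose_mul_div_le {ε : ℝ} (hε : 0 < ε) (hε1 : ε ≤ 1) (k : ℕ) :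
    ∑ j ∈ Finset.range (k + 1), (k.choose j : ℝ) * (ε ^ j * (1 - ε) ^ (k - j)) * (1 / (j + 1))
      ≤ 1 / (ε * (k + 1)) := by
  have h : ∀ j ∈ Finset.range (k + 1),
      (k.choose j : ℝ) * (ε ^ j * (1 - ε) ^ (k - j)) * (1 / (j + 1)) =
        1 / (ε * (k + 1)) *
          (ε ^ (j + 1) * (1 - ε) ^ (k + 1 - (j + 1)) * ((k + 1).choose (j + 1) : ℝ)) := by
    intro j _
    have h2 : ((k : ℝ) + 1) * (k.choose j : ℝ) = ((k + 1).choose (j + 1) : ℝ) * (j + 1) := by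
      exact_mod_cast Nat.add_one_mul_choose_eq k j
    have h3 : ((k + 1).choose (j + 1) : ℝ) = ((k : ℝ) + 1) * (k.choose j : ℝ) / (j + 1) := by
      field_simp; linarith
    rw [h3, Nat.add_sub_add_right, pow_succ]
    field_simp
  rw [Finset.sum_congr rfl h, ← Finset.mul_sum]
  refine mul_le_of_le_one_right (by positivity) ?_
  have h4 := add_pow ε (1 - ε) (k + 1)
  rw [Finset.sum_range_succ'] at h4
  have h5 : 0 ≤ (1 - ε) ^ (k + 1) := pow_nonneg (by linarith) _
  simp only [add_sub_cancel, one_pow, pow_zero, one_mul, Nat.sub_zero, Nat.choose_zero_right,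
    Nat.cast_one, mul_one] at h4
  linarith

lemma sum_choose_mul_eq_one (ε : ℝ) (k : ℕ) :
    ∑ j ∈ Finset.range (k + 1), (k.choose j : ℝ) * (ε ^ j * (1 - ε) ^ (k - j)) = 1 := by
  have h := add_pow ε (1 - ε) k
  rw [add_sub_cancel, one_pow] at h
  exact (Finset.sum_congr rfl fun j _ => by ring).trans h.symm

/-- Decay of the powers of `b` survives mixing with a commuting remainder `D`: among `k` factors,
binomially many are equal to `b`. -/
lemma norm_smul_add_pow_mul_le_div {b D x : 𝔸} {ε c : ℝ} (hε : 0 < ε) (hε1 : ε ≤ 1)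
    (hbD : Commute b D) (hD : ‖D‖ ≤ 1 - ε) (hb : ∀ j : ℕ, ‖b ^ j * x‖ ≤ c / (j + 1)) (k : ℕ) :
    ‖(ε • b + D) ^ k * x‖ ≤ c / ε / (k + 1) := by
  have hc : 0 ≤ c := by simpa using (norm_nonneg _).trans (hb 0)
  refine (norm_smul_add_pow_mul_le hε.le hbD hD hb k).trans ?_
  calc _ = c * ∑ j ∈ Finset.range (k + 1),
        (k.choose j : ℝ) * (ε ^ j * (1 - ε) ^ (k - j)) * (1 / (j + 1)) := by
        rw [Finset.mul_sum]; exact Finset.sum_congr rfl fun j _ => by ring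
    _ ≤ c * (1 / (ε * (k + 1))) :=
        mul_le_mul_of_nonneg_left (sum_choose_mul_div_le hε hε1 k) hc
    _ = _ := by field_simp

lemma one_div_sqrt_le {s : ℝ} (hs : 0 < s) {t : ℝ} (ht : 0 < t) :
    1 / √t ≤ (s * (1 / t) + 1 / s) / 2 := by
  have h1 : 1 / t = (1 / √t) ^ 2 := by rw [div_pow, Real.sq_sqrt ht.le, one_pow]
  have h2 : 0 < 1 / √t := by positivity
  rw [h1, le_div_iff₀ (by norm_num)]
  generalize 1 / √t = u at *
  have h3 : s * u ^ 2 + 1 / s - u * 2 = (s * u - 1) ^ 2 / s := by field_simp; ring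
  have : 0 ≤ (s * u - 1) ^ 2 / s := by positivity
  linarith

lemma norm_smul_add_pow_mul_le_div_sqrt {b D x : 𝔸} {ε c : ℝ} (hε : 0 < ε) (hε1 : ε ≤ 1)
    (hbD : Commute b D) (hD : ‖D‖ ≤ 1 - ε) (hb : ∀ j : ℕ, ‖b ^ j * x‖ ≤ c / √(j + 1)) (k : ℕ) :
    ‖(ε • b + D) ^ k * x‖ ≤ c / ε / √(k + 1) := by
  have hc : 0 ≤ c := by simpa using (norm_nonneg _).trans (hb 0)
  have hs : 0 < √((k : ℝ) + 1) := by positivity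
  have hss : √((k : ℝ) + 1) * √((k : ℝ) + 1) = k + 1 := Real.mul_self_sqrt (by positivity)
  refine (norm_smul_add_pow_mul_le hε.le hbD hD hb k).trans ?_
  -- Linearizing `1/√t` with slope parameter `s = √(k+1)` reduces the claim to the mean of `1/(j+1)`
  -- and balances the two resulting terms.
  set s := √((k : ℝ) + 1) with hsdef
  calc _ ≤ ∑ j ∈ Finset.range (k + 1), (k.choose j : ℝ) * (ε ^ j * (1 - ε) ^ (k - j)) *
        (c * ((s * (1 / (j + 1)) + 1 / s) / 2)) := by
        refine Finset.sum_le_sum fun j _ => mul_le_mul_of_nonneg_left ?_ ?_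
        · rw [div_eq_mul_one_div]
          exact mul_le_mul_of_nonneg_left (one_div_sqrt_le hs (by positivity)) hc
        · have : 0 ≤ 1 - ε := by linarith
          positivity
    _ = c / 2 * (s * (∑ j ∈ Finset.range (k + 1),
          (k.choose j : ℝ) * (ε ^ j * (1 - ε) ^ (k - j)) * (1 / (j + 1))) +
        (1 / s) * ∑ j ∈ Finset.range (k + 1),
          (k.choose j : ℝ) * (ε ^ j * (1 - ε) ^ (k - j))) := by
        rw [Finset.mul_sum, Finset.mul_sum, ← Finset.sum_add_distrib, Finset.mul_sum]
        exact Finset.sum_congr rfl fun j _ => by ring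
    _ ≤ c / 2 * (s * (1 / (ε * (k + 1))) + (1 / s) * (1 / ε)) := by
        rw [sum_choose_mul_eq_one]
        have h1 : 1 ≤ 1 / ε := by rw [le_div_iff₀ hε]; linarith
        have := sum_choose_mul_div_le hε hε1 k
        gcongr
    _ = _ := by
        rw [← hss]; field_simp; ring

/-- The variance of the symmetric binomial law, read off from Bernstein polynomials at `1/2`. -/
lemma sum_choose_mul_sq (n : ℕ) :
    ∑ m ∈ Finset.range (n + 1), (n.choose m : ℝ) * ((n : ℝ) - 2 * m) ^ 2 =
      (n : ℝ) * 2 ^ n := by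
  have h := congrArg (Polynomial.eval (1 / 2 : ℝ)) (bernsteinPolynomial.variance ℝ n)
  simp only [Polynomial.eval_finsetSum, Polynomial.eval_mul, Polynomial.eval_pow,
    Polynomial.eval_sub, Polynomial.eval_X, Polynomial.eval_natCast,
    Polynomial.eval_one, bernsteinPolynomial, nsmul_eq_mul] at h
  have h2 : ∀ m ∈ Finset.range (n + 1), (n.choose m : ℝ) * ((n : ℝ) - 2 * m) ^ 2 =
      4 * 2 ^ n * (((n : ℝ) * (1 / 2) - m) ^ 2 *
        ((n.choose m : ℝ) * (1 / 2) ^ m * (1 - 1 / 2) ^ (n - m))) := by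
    intro m hm
    have h3 : (1 / 2 : ℝ) ^ m * (1 - 1 / 2) ^ (n - m) = 1 / 2 ^ n := by
      rw [show (1 - 1 / 2 : ℝ) = 1 / 2 by norm_num, ← pow_add,
        Nat.add_sub_cancel' (Nat.lt_succ_iff.mp (Finset.mem_range.mp hm)), one_div_pow]
    rw [mul_assoc (n.choose m : ℝ), h3]
    field_simp
    ring
  rw [Finset.sum_congr rfl h2, ← Finset.mul_sum, h]
  ring

lemma sum_choose_mul_abs_le (n : ℕ) :
    ∑ m ∈ Finset.range (n + 1), (n.choose m : ℝ) * |(n : ℝ) - 2 * m| ≤ √n * 2 ^ n := by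
  have h := Finset.sum_mul_sq_le_sq_mul_sq (Finset.range (n + 1))
    (fun m => √(n.choose m : ℝ)) (fun m => √(n.choose m : ℝ) * |(n : ℝ) - 2 * m|)
  have h1 : ∀ m, √(n.choose m : ℝ) * (√(n.choose m : ℝ) * |(n : ℝ) - 2 * m|) =
      (n.choose m : ℝ) * |(n : ℝ) - 2 * m| := fun m => by
    rw [← mul_assoc, Real.mul_self_sqrt (by positivity)]
  have h2 : ∀ m, (√(n.choose m : ℝ) * |(n : ℝ) - 2 * m|) ^ 2 =
      (n.choose m : ℝ) * ((n : ℝ) - 2 * m) ^ 2 := fun m => by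
    rw [mul_pow, Real.sq_sqrt (by positivity), sq_abs]
  have h3 : ∑ m ∈ Finset.range (n + 1), (n.choose m : ℝ) = 2 ^ n := by
    exact_mod_cast Nat.sum_range_choose n
  simp only [h1, h2, sum_choose_mul_sq, Real.sq_sqrt (Nat.cast_nonneg _), h3] at h
  refine abs_le_of_sq_le_sq' (h.trans (le_of_eq ?_)) (by positivity) |>.2
  rw [mul_pow, Real.sq_sqrt (by positivity)]; ring

/-- The total variation between consecutive binomial laws, in a normed algebra. -/
lemma norm_half_one_add_pow_mul_one_sub_le {y : 𝔸} (hy : ‖y‖ ≤ 1) (i : ℕ) :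
    ‖((1 / 2 : ℝ) • (1 + y)) ^ i * (1 - y)‖ ≤ 2 / √(i + 1) := by
  have h := congrArg norm (one_add_pow_mul_one_sub y i)
  have h1 : ‖∑ m ∈ Finset.range (i + 2),
      (((i + 1).choose m : ℝ) * (((i + 1 : ℕ) : ℝ) - 2 * m)) • y ^ m‖ ≤
        √((i : ℝ) + 1) * 2 ^ (i + 1) := by
    have h0 := sum_choose_mul_abs_le (i + 1)
    push_cast at h0
    refine (norm_sum_le _ _).trans (le_trans (Finset.sum_le_sum fun m _ => ?_) h0)
    rw [norm_smul, norm_mul, Real.norm_natCast, Real.norm_eq_abs]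
    push_cast
    refine mul_le_of_le_one_right (by positivity) ((norm_pow_le _ _).trans ?_)
    exact pow_le_one₀ (norm_nonneg _) hy
  rw [← h, norm_smul, Real.norm_of_nonneg (by positivity)] at h1
  have hs : 0 < √((i : ℝ) + 1) := by positivity
  have hss : √((i : ℝ) + 1) * √((i : ℝ) + 1) = i + 1 := Real.mul_self_sqrt (by positivity)
  rw [smul_pow, smul_mul_assoc, norm_smul, Real.norm_of_nonneg (by positivity), one_div_pow,
    le_div_iff₀ hs, one_div, inv_mul_eq_div, div_mul_eq_mul_div, div_le_iff₀ (by positivity)]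
  have h2 : √((i : ℝ) + 1) * (√((i : ℝ) + 1) * ‖(1 + y) ^ i * (1 - y)‖) ≤
      √((i : ℝ) + 1) * 2 ^ (i + 1) := by rw [← mul_assoc, hss]; exact h1
  have h3 := le_of_mul_le_mul_left h2 hs
  rw [pow_succ] at h3
  linarith

lemma norm_smul_one_add_add_pow_mul_le {y D : 𝔸} {c : ℝ} (hc : 0 < c) (hc1 : 2 * c ≤ 1)
    (hy : ‖y‖ ≤ 1) (hyD : Commute y D) (hD : ‖D‖ ≤ 1 - 2 * c) (k : ℕ) :
    ‖(c • (1 + y) + D) ^ k * (1 - y)‖ ≤ 1 / c / √(k + 1) := by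
  have h := norm_smul_add_pow_mul_le_div_sqrt (b := (1 / 2 : ℝ) • (1 + y)) (D := D)
    (by linarith : 0 < 2 * c) hc1
    (((Commute.one_left D).add_left hyD).smul_left _) hD
    (norm_half_one_add_pow_mul_one_sub_le hy) k
  rw [smul_smul, show 2 * c * (1 / 2) = c by ring] at h
  refine h.trans (le_of_eq ?_)
  field_simp

end Smoothing

/-! ### Averages of a representation over a measure -/

section Average

variable {G : Type*} [Group G] [MeasurableSpace G] [DiscreteMeasurableSpace G] [Countable G]
  {𝔸 : Type*} [NormedRing 𝔸] [NormedAlgebra ℝ 𝔸]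

instance (priority := 100) measurableMul₂_of_discrete_of_countable : MeasurableMul₂ G :=
  ⟨Measurable.of_discrete⟩

instance isFiniteMeasure_convPower (ν : Measure G) [IsFiniteMeasure ν] (n : ℕ) :
    IsFiniteMeasure (convPower ν n) := by
  induction n with
  | zero => exact inferInstanceAs (IsFiniteMeasure (Measure.dirac (1 : G)))
  | succ n ih => exact inferInstanceAs (IsFiniteMeasure ((convPower ν n).mconv ν))

instance isProbabilityMeasure_convPower (ν : Measure G) [IsProbabilityMeasure ν] (n : ℕ) :
    IsProbabilityMeasure (convPower ν n) := by
  induction n with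
  | zero => exact inferInstanceAs (IsProbabilityMeasure (Measure.dirac (1 : G)))
  | succ n ih => exact inferInstanceAs (IsProbabilityMeasure ((convPower ν n).mconv ν))

/-- The average of a representation `T` with respect to the measure `ν`. -/
noncomputable def avg (T : G →* 𝔸) (ν : Measure G) : 𝔸 := ∫ g, T g ∂ν

variable {T : G →* 𝔸}

lemma integrable_rep (hT : ∀ g, ‖T g‖ ≤ 1) (ν : Measure G) [IsFiniteMeasure ν] :
    Integrable (fun g => T g) ν :=
  Integrable.of_bound .of_discrete 1 (ae_of_all _ hT)

lemma norm_avg_le (hT : ∀ g, ‖T g‖ ≤ 1) (ν : Measure G) [IsFiniteMeasure ν] :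
    ‖avg T ν‖ ≤ ν.real Set.univ := by
  simpa [avg] using norm_integral_le_of_norm_le_const (ae_of_all ν hT)

lemma avg_add (hT : ∀ g, ‖T g‖ ≤ 1) (ν₁ ν₂ : Measure G) [IsFiniteMeasure ν₁]
    [IsFiniteMeasure ν₂] : avg T (ν₁ + ν₂) = avg T ν₁ + avg T ν₂ :=
  integral_add_measure (integrable_rep hT _) (integrable_rep hT _)

lemma avg_smul (c : ℝ≥0∞) (ν : Measure G) : avg T (c • ν) = c.toReal • avg T ν :=
  integral_smul_measure _ c

variable [CompleteSpace 𝔸]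

lemma avg_dirac (g : G) : avg T (Measure.dirac g) = T g :=
  integral_dirac _ _

lemma mul_avg (hT : ∀ g, ‖T g‖ ≤ 1) (X : 𝔸) (ν : Measure G) [IsFiniteMeasure ν] :
    X * avg T ν = ∫ g, X * T g ∂ν :=
  (integral_const_mul_of_integrable (integrable_rep hT ν)).symm

lemma avg_mul (hT : ∀ g, ‖T g‖ ≤ 1) (X : 𝔸) (ν : Measure G) [IsFiniteMeasure ν] :
    avg T ν * X = ∫ g, T g * X ∂ν :=
  (integral_mul_const_of_integrable (integrable_rep hT ν)).symm

lemma commute_avg (hT : ∀ g, ‖T g‖ ≤ 1) {X : 𝔸} (hX : ∀ g, Commute X (T g)) (ν : Measure G)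
    [IsFiniteMeasure ν] : Commute X (avg T ν) := by
  rw [commute_iff_eq, mul_avg hT, avg_mul hT]
  exact integral_congr_ae (ae_of_all _ fun g => hX g)

lemma avg_mconv (hT : ∀ g, ‖T g‖ ≤ 1) (ν₁ ν₂ : Measure G) [IsFiniteMeasure ν₁]
    [IsFiniteMeasure ν₂] : avg T (ν₁.mconv ν₂) = avg T ν₁ * avg T ν₂ := by
  rw [avg_mul hT, avg, integral_mconv (integrable_rep hT _)]
  refine integral_congr_ae (ae_of_all _ fun g => ?_)
  simp only [map_mul]
  exact (mul_avg hT (T g) ν₂).symm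

lemma avg_convPower (hT : ∀ g, ‖T g‖ ≤ 1) (ν : Measure G) [IsFiniteMeasure ν] (n : ℕ) :
    avg T (convPower ν n) = avg T ν ^ n := by
  induction n with
  | zero => rw [pow_zero, ← map_one T]; exact avg_dirac 1
  | succ n ih => rw [pow_succ, ← ih]; exact avg_mconv hT _ _

lemma avg_map {G' : Type*} [Group G'] [MeasurableSpace G'] [DiscreteMeasurableSpace G']
    (f : G' →* G) (ν : Measure G') : avg T (ν.map f) = avg (T.comp f) ν :=
  integral_map Measurable.of_discrete.aemeasurable .of_discrete

end Average

/-! ### Averages over product and noise measures -/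

section Product

variable {Γ : Type*} [Group Γ] [MeasurableSpace Γ] [DiscreteMeasurableSpace Γ] [Countable Γ]
  {𝔸 : Type*} [NormedRing 𝔸] [NormedAlgebra ℝ 𝔸] [CompleteSpace 𝔸] {T : Γ × Γ →* 𝔸}

lemma avg_prod (hT : ∀ g, ‖T g‖ ≤ 1) (ν₁ ν₂ : Measure Γ) [IsFiniteMeasure ν₁]
    [IsFiniteMeasure ν₂] : avg T (ν₁.prod ν₂) =
      avg (T.comp (MonoidHom.inl Γ Γ)) ν₁ * avg (T.comp (MonoidHom.inr Γ Γ)) ν₂ := by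
  have h1 : ∀ g, ‖T.comp (MonoidHom.inl Γ Γ) g‖ ≤ 1 := fun g => hT _
  have h2 : ∀ g, ‖T.comp (MonoidHom.inr Γ Γ) g‖ ≤ 1 := fun g => hT _
  rw [avg_mul h1, avg, integral_prod _ (integrable_rep hT _)]
  refine integral_congr_ae (ae_of_all _ fun g => ?_)
  simp only
  rw [mul_avg h2]
  refine integral_congr_ae (ae_of_all _ fun h => ?_)
  simp [← map_mul]

lemma commute_inl_inr (g h : Γ) :
    Commute (T.comp (MonoidHom.inl Γ Γ) g) (T.comp (MonoidHom.inr Γ Γ) h) := by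
  simp [commute_iff_eq, ← map_mul]

lemma avg_prod_convPower (hT : ∀ g, ‖T g‖ ≤ 1) (μ : Measure Γ) [IsFiniteMeasure μ] (n : ℕ) :
    avg T ((convPower μ n).prod (convPower μ n)) = avg T (μ.prod μ) ^ n := by
  have h1 : ∀ g, ‖T.comp (MonoidHom.inl Γ Γ) g‖ ≤ 1 := fun g => hT _
  have h2 : ∀ g, ‖T.comp (MonoidHom.inr Γ Γ) g‖ ≤ 1 := fun g => hT _
  rw [avg_prod hT, avg_prod hT, avg_convPower h1, avg_convPower h2, Commute.mul_pow]
  exact commute_avg h2 (fun h => (commute_avg h1 (fun g => (commute_inl_inr g h).symm) μ).symm) _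

lemma isProbabilityMeasure_noiseMeasure (μ : Measure Γ) [IsProbabilityMeasure μ] {ρ : ℝ}
    (h0 : 0 ≤ ρ) (h1 : ρ ≤ 1) : IsProbabilityMeasure (noiseMeasure μ ρ) := by
  constructor
  have : (μ.map fun g => (g, g)) Set.univ = 1 := by
    rw [Measure.map_apply Measurable.of_discrete MeasurableSet.univ]; simp
  simp [noiseMeasure, this]
  rw [← ENNReal.ofReal_add h0 (by linarith)]
  simp

instance isFiniteMeasure_noiseMeasure (μ : Measure Γ) [IsProbabilityMeasure μ] (ρ : ℝ) :
    IsFiniteMeasure (noiseMeasure μ ρ) := by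
  unfold noiseMeasure
  have : IsFiniteMeasure (ENNReal.ofReal ρ • μ.prod μ) := Measure.smul_finite _ (by simp)
  have : IsFiniteMeasure (ENNReal.ofReal (1 - ρ) • μ.map fun g => (g, g)) :=
    Measure.smul_finite _ (by simp)
  infer_instance

/-- The diagonal embedding of a group. -/
def diagHom (Γ : Type*) [Group Γ] : Γ →* Γ × Γ := (MonoidHom.id Γ).prod (MonoidHom.id Γ)

lemma avg_noiseMeasure (hT : ∀ g, ‖T g‖ ≤ 1) (μ : Measure Γ) [IsProbabilityMeasure μ] {ρ : ℝ}
    (h0 : 0 ≤ ρ) (h1 : ρ ≤ 1) : avg T (noiseMeasure μ ρ) =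
      avg T (μ.prod μ) + (1 - ρ) • (avg (T.comp (diagHom Γ)) μ - avg T (μ.prod μ)) := by
  have hf1 : IsFiniteMeasure (ENNReal.ofReal ρ • μ.prod μ) := Measure.smul_finite _ (by simp)
  have hf2 : IsFiniteMeasure (ENNReal.ofReal (1 - ρ) • μ.map fun g => (g, g)) :=
    Measure.smul_finite _ (by simp)
  rw [noiseMeasure, avg_add hT, avg_smul, avg_smul, ENNReal.toReal_ofReal h0,
    ENNReal.toReal_ofReal (by linarith), show (fun g : Γ => (g, g)) = diagHom Γ from rfl, avg_map]
  module

end Product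

/-! ### Word length -/

section WordLength

variable {Γ : Type*} [Group Γ] {S : Set Γ}

lemma exists_word (hS : Subgroup.closure S = ⊤) (g : Γ) :
    ∃ l : List Γ, l.length = wordLength S g ∧ (∀ s ∈ l, s ∈ S ∨ s⁻¹ ∈ S) ∧ l.prod = g := by
  have h : {n : ℕ | ∃ l : List Γ, l.length = n ∧ (∀ s ∈ l, s ∈ S ∨ s⁻¹ ∈ S) ∧
      l.prod = g}.Nonempty := by
    have hg : g ∈ (Subgroup.closure S).toSubmonoid := by rw [hS]; trivial
    rw [Subgroup.closure_toSubmonoid] at hg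
    obtain ⟨l, hl, hg⟩ := Submonoid.exists_list_of_mem_closure hg
    exact ⟨l.length, l, rfl, hl, hg⟩
  exact Nat.sInf_mem h

lemma wordLength_le_length {l : List Γ} (hl : ∀ s ∈ l, s ∈ S ∨ s⁻¹ ∈ S) :
    wordLength S l.prod ≤ l.length :=
  Nat.sInf_le ⟨l, rfl, hl, rfl⟩

lemma wordLength_mul_le (hS : Subgroup.closure S = ⊤) (g h : Γ) :
    wordLength S (g * h) ≤ wordLength S g + wordLength S h := by
  obtain ⟨l₁, h₁, hl₁, rfl⟩ := exists_word hS g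
  obtain ⟨l₂, h₂, hl₂, rfl⟩ := exists_word hS h
  rw [← h₁, ← h₂, ← List.length_append, ← List.prod_append]
  refine wordLength_le_length fun s hs => ?_
  rcases List.mem_append.mp hs with h | h
  exacts [hl₁ s h, hl₂ s h]

lemma wordLength_inv_le (hS : Subgroup.closure S = ⊤) (g : Γ) :
    wordLength S g⁻¹ ≤ wordLength S g := by
  obtain ⟨l, h, hl, rfl⟩ := exists_word hS g
  rw [← h, List.prod_inv_reverse]
  refine (wordLength_le_length fun s hs => ?_).trans (by simp)
  simp only [List.mem_reverse, List.mem_map] at hs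
  obtain ⟨a, ha, rfl⟩ := hs
  rw [inv_inv]
  exact (hl a ha).symm

lemma wordLength_inv (hS : Subgroup.closure S = ⊤) (g : Γ) :
    wordLength S g⁻¹ = wordLength S g :=
  le_antisymm (wordLength_inv_le hS g) (by simpa using wordLength_inv_le hS g⁻¹)

lemma countable_of_closure_eq_top (hSf : S.Finite) (hS : Subgroup.closure S = ⊤) :
    Countable Γ := by
  have hS' : {s | s ∈ S ∨ s⁻¹ ∈ S}.Finite := hSf.union (hSf.preimage inv_injective.injOn)
  have : Countable {s | s ∈ S ∨ s⁻¹ ∈ S} := hS'.countable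
  refine Function.Surjective.countable
    (f := fun l : List {s | s ∈ S ∨ s⁻¹ ∈ S} => (l.map Subtype.val).prod) fun g => ?_
  obtain ⟨l, -, hl, rfl⟩ := exists_word hS g
  lift l to List {s | s ∈ S ∨ s⁻¹ ∈ S} using hl
  exact ⟨l, rfl⟩

end WordLength

/-! ### The subgroup attached to the period of the walk -/

section Period

open scoped Pointwise

variable {Γ : Type*} [Group Γ]

/-- If `S` generates `Γ` as a semigroup, there is a normal subgroup `N` of finite index with
`S` contained in one coset of `N`, all of whose finite subsets are contained in a power of `S`. -/
lemma exists_period_subgroup {S : Set Γ} (hS : Subsemigroup.closure S = ⊤) :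
    ∃ N : Subgroup Γ, N.Normal ∧ N.FiniteIndex ∧ (∀ g ∈ S, ∀ h ∈ S, g * h⁻¹ ∈ N) ∧
      ∀ F : Finset Γ, (∀ f ∈ F, f ∈ N) → ∃ L : ℕ, 0 < L ∧ ∀ f ∈ F, f ∈ S ^ L := by
  have hpow : ∀ g : Γ, ∃ k, g ∈ S ^ (k + 1) := by
    intro g
    have hg : g ∈ Subsemigroup.closure S := by rw [hS]; trivial
    induction hg using Subsemigroup.closure_induction with
    | mem x hx => exact ⟨0, by simpa using hx⟩
    | mul x y _ _ hx hy =>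
      obtain ⟨a, ha⟩ := hx
      obtain ⟨b, hb⟩ := hy
      refine ⟨a + 1 + b, ?_⟩
      rw [show a + 1 + b + 1 = (a + 1) + (b + 1) by ring, pow_add]
      exact Set.mul_mem_mul ha hb
  -- Since `1 ∈ S^(m+1)`, exponents matter only modulo `m+1`; `N` consists of the elements reached
  -- with exponent divisible by `m+1`.
  obtain ⟨m, hm⟩ := hpow 1
  have hmul : ∀ {g h : Γ} {i j : ℕ}, g ∈ S ^ i → h ∈ S ^ j → g * h ∈ S ^ (i + j) :=
    fun hg hh => by rw [pow_add]; exact Set.mul_mem_mul hg hh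
  have hpp : ∀ {g : Γ} {i : ℕ} (n : ℕ), g ∈ S ^ i → g ^ n ∈ S ^ (i * n) :=
    fun n hg => by rw [pow_mul]; exact Set.pow_mem_pow hg
  have hone : ∀ j, (1 : Γ) ∈ S ^ ((m + 1) * j) := fun j => by simpa using hpp j hm
  let N : Subgroup Γ :=
    { carrier := {g | ∃ j, g ∈ S ^ ((m + 1) * j)}
      one_mem' := ⟨1, hone 1⟩
      mul_mem' := by
        rintro a b ⟨i, hi⟩ ⟨j, hj⟩
        exact ⟨i + j, by rw [mul_add]; exact hmul hi hj⟩
      inv_mem' := by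
        rintro g ⟨j, hj⟩
        obtain ⟨i, hi⟩ := hpow g⁻¹
        refine ⟨(i + 1) + j * m, ?_⟩
        have h := hmul (hpp (m + 1) hi) (hpp m hj)
        rw [show (i + 1) * (m + 1) + (m + 1) * j * m = (m + 1) * ((i + 1) + j * m) by ring] at h
        rwa [show g⁻¹ ^ (m + 1) * g ^ m = g⁻¹ by rw [inv_pow, pow_succ]; group] at h }
  -- An inverse can be reached with exponent congruent to `-i` modulo `m+1`, because `i * m` is.
  have hinv : ∀ {g : Γ} {i : ℕ}, g ∈ S ^ i → ∃ j, g⁻¹ ∈ S ^ (i * m + (m + 1) * j) := by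
    intro g i hg
    have h1 : g ^ (m + 1) ∈ N := ⟨i, by rw [mul_comm]; exact hpp (m + 1) hg⟩
    obtain ⟨j, hj⟩ := N.inv_mem h1
    refine ⟨j, ?_⟩
    have h := hmul (hpp m hg) hj
    rwa [show g ^ m * (g ^ (m + 1))⁻¹ = g⁻¹ by rw [pow_succ']; group] at h
  have hcos : ∀ {g h : Γ} {i : ℕ}, g ∈ S ^ i → h ∈ S ^ i → g * h⁻¹ ∈ N := by
    intro g h i hg hh
    obtain ⟨j, hj⟩ := hinv hh
    refine ⟨i + j, ?_⟩
    have h2 := hmul hg hj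
    rwa [show i + (i * m + (m + 1) * j) = (m + 1) * (i + j) by ring] at h2
  have hN : N.Normal := by
    constructor
    rintro n ⟨j, hn⟩ g
    obtain ⟨i, hi⟩ := hpow g
    obtain ⟨k, hk⟩ := hinv hi
    refine ⟨i + 1 + j + k, ?_⟩
    have h2 := hmul (hmul hi hn) hk
    rwa [show i + 1 + (m + 1) * j + ((i + 1) * m + (m + 1) * k) = (m + 1) * (i + 1 + j + k)
      by ring] at h2
  refine ⟨N, hN, ?_, fun g hg h hh => hcos (i := 1) (by simpa using hg) (by simpa using hh), ?_⟩
  · obtain ⟨s, hs⟩ : S.Nonempty := by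
      rw [Set.nonempty_iff_ne_empty]
      rintro rfl
      rw [Set.empty_pow (by omega)] at hm
      exact hm
    have hs1 : s ∈ S ^ 1 := by simpa using hs
    have hsN : s ^ (m + 1) ∈ N := ⟨1, by simpa using hpp (m + 1) hs1⟩
    -- The quotient is cyclic, generated by the class of any `s ∈ S`, and `s^(m+1) ∈ N`.
    have : Finite (Γ ⧸ N) := by
      refine Finite.of_surjective (fun i : Fin (m + 1) => ((s ^ (i : ℕ) : Γ) : Γ ⧸ N)) ?_
      intro q
      induction q using QuotientGroup.induction_on with
      | H g =>
        obtain ⟨k, hk⟩ := hpow g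
        refine ⟨⟨(k + 1) % (m + 1), Nat.mod_lt _ (by omega)⟩, ?_⟩
        have h1 : ((g : Γ) : Γ ⧸ N) = ((s ^ (k + 1) : Γ) : Γ ⧸ N) := by
          have h3 := hcos hk (by simpa using hpp (k + 1) hs1)
          have h4 := (QuotientGroup.eq_one_iff (N := N) _).mpr h3
          rw [QuotientGroup.mk_mul, QuotientGroup.mk_inv, mul_inv_eq_one] at h4
          exact h4
        rw [h1]
        have h5 : ((s ^ (m + 1) : Γ) : Γ ⧸ N) = 1 := (QuotientGroup.eq_one_iff _).mpr hsN
        have h6 := Nat.mod_add_div (k + 1) (m + 1)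
        conv_rhs => rw [← h6, pow_add, pow_mul, QuotientGroup.mk_mul,
          QuotientGroup.mk_pow _ (s ^ (m + 1)), h5]
        simp
    exact Subgroup.finiteIndex_of_finite_quotient
  · intro F hF
    choose! j hj using hF
    -- Shorter words are padded by `1 ∈ S^(m+1)` to a common length; the `+ 1` keeps it positive.
    refine ⟨(m + 1) * (F.sup j + 1), by positivity, fun f hf => ?_⟩
    have h := hmul (hj f hf) (hone (F.sup j + 1 - j f))
    rwa [mul_one, ← mul_add, Nat.add_sub_cancel' ((Finset.le_sup hf).trans (Nat.le_succ _))] at h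

end Period

/-! ### Schreier generators of an abelian normal subgroup -/

section Schreier

variable {Γ : Type*} [Group Γ]

/-- A virtually abelian group has normal abelian subgroups of finite index in any given subgroup of
finite index; together with a finite conjugation invariant set in whose terms the word length on
the subgroup does not exceed the word length of the ambient group. -/
lemma exists_abelian_normal_undistorted (hΓ : IsVirtuallyAbelian Γ) {S : Set Γ} (hSf : S.Finite)
    (hS : Subgroup.closure S = ⊤) (N : Subgroup Γ) [N.FiniteIndex] :
    ∃ A : Subgroup Γ, A.Normal ∧ A.FiniteIndex ∧ A ≤ N ∧ (∀ a ∈ A, ∀ b ∈ A, a * b = b * a) ∧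
      ∃ F : Finset Γ, (∀ f ∈ F, f ∈ A) ∧ 1 ∈ F ∧ (∀ g, ∀ f ∈ F, g * f * g⁻¹ ∈ F) ∧
        ∀ t ∈ A, ∃ l : List Γ, l.length ≤ wordLength S t ∧ (∀ s ∈ l, s ∈ F) ∧ l.prod = t := by
  obtain ⟨H, hHf, hH⟩ := hΓ
  have hA1 : (H ⊓ N).normalCore ≤ H ⊓ N := Subgroup.normalCore_le _
  have hAf : (H ⊓ N).normalCore.FiniteIndex := inferInstance
  have hAn : (H ⊓ N).normalCore.Normal := inferInstance
  generalize (H ⊓ N).normalCore = A at *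
  have hcomm : ∀ a ∈ A, ∀ b ∈ A, a * b = b * a :=
    fun a ha b hb => hH a (hA1 ha).1 b (hA1 hb).1
  refine ⟨A, hAn, hAf, fun a ha => (hA1 ha).2, hcomm, ?_⟩
  have hfin : Finite (Γ ⧸ A) := inferInstance
  let r : Γ ⧸ A → Γ := Quotient.out
  have hr : ∀ q : Γ ⧸ A, ((r q : Γ) : Γ ⧸ A) = q := fun q => Quotient.out_eq q
  -- The Schreier generators. Rewriting a word letter by letter telescopes the representatives and
  -- preserves the length.
  let e : Γ ⧸ A → Γ → Γ := fun q s => r q * s * (r (q * (s : Γ ⧸ A)))⁻¹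
  have he : ∀ q s, e q s ∈ A := fun q s => by
    rw [← QuotientGroup.eq_one_iff]
    simp [e, hr]
  let S' : Set Γ := {s | s ∈ S ∨ s⁻¹ ∈ S}
  have hS' : S'.Finite := hSf.union (hSf.preimage inv_injective.injOn)
  let F₀ : Set Γ := insert 1 (Set.image2 e Set.univ S')
  have hF₀ : F₀.Finite := (Set.Finite.image2 _ Set.finite_univ hS').insert 1
  have hF₀A : ∀ f ∈ F₀, f ∈ A := by
    rintro f (rfl | ⟨q, -, s, -, rfl⟩)
    exacts [A.one_mem, he q s]
  -- Conjugating by coset representatives is enough for full conjugation invariance: since `A` is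
  -- abelian, the conjugate of an element of `A` depends only on the coset of the conjugating
  -- element.
  let F : Set Γ := Set.image2 (fun q f => r q * f * (r q)⁻¹) Set.univ F₀
  have hF : F.Finite := Set.Finite.image2 _ Set.finite_univ hF₀
  have hr1 : r 1 ∈ A := by rw [← QuotientGroup.eq_one_iff, hr]
  have hF₀F : ∀ f ∈ F₀, f ∈ F := fun f hf =>
    ⟨1, trivial, f, hf, by
      show r 1 * f * (r 1)⁻¹ = f
      rw [hcomm _ hr1 _ (hF₀A f hf)]; group⟩
  have hword : ∀ l : List Γ, (∀ s ∈ l, s ∈ S') → ∀ q : Γ ⧸ A,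
      ∃ l' : List Γ, l'.length = l.length ∧ (∀ s ∈ l', s ∈ F₀) ∧ l'.prod = e q l.prod := by
    intro l
    induction l with
    | nil => exact fun _ q => ⟨[], rfl, by simp, by simp [e]⟩
    | cons s l ih =>
      intro hl q
      obtain ⟨l', h1, h2, h3⟩ := ih (fun x hx => hl x (by simp [hx])) (q * (s : Γ ⧸ A))
      refine ⟨e q s :: l', by simp [h1], ?_, ?_⟩
      · intro x hx
        rcases List.mem_cons.mp hx with rfl | hx
        · exact Or.inr ⟨q, trivial, s, hl s (by simp), rfl⟩
        · exact h2 x hx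
      · rw [List.prod_cons, h3, List.prod_cons]
        simp only [e, QuotientGroup.mk_mul, mul_assoc, inv_mul_cancel_left]
  refine ⟨hF.toFinset, ?_, ?_, ?_, ?_⟩
  · intro f hf
    obtain ⟨q, -, f, hf₀, rfl⟩ := hF.mem_toFinset.mp hf
    exact hAn.conj_mem f (hF₀A f hf₀) _
  · exact hF.mem_toFinset.mpr (hF₀F 1 (Or.inl rfl))
  · intro g f hf
    obtain ⟨q, -, f, hf₀, rfl⟩ := hF.mem_toFinset.mp hf
    refine hF.mem_toFinset.mpr ⟨((g * r q : Γ) : Γ ⧸ A), trivial, f, hf₀, ?_⟩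
    show r _ * f * (r _)⁻¹ = g * (r q * f * (r q)⁻¹) * g⁻¹
    have ha : (g * r q)⁻¹ * r ((g * r q : Γ) : Γ ⧸ A) ∈ A := QuotientGroup.eq.mp (hr _).symm
    have h2 := hcomm _ ha _ (hF₀A f hf₀)
    generalize r ((g * r q : Γ) : Γ ⧸ A) = x at *
    have h3 : x * f = g * r q * f * ((g * r q)⁻¹ * x) := by
      rw [mul_assoc (g * r q), ← h2]; group
    rw [h3]; group
  · intro t ht
    obtain ⟨l, h1, h2, rfl⟩ := exists_word hS t
    obtain ⟨l', h3, h4, h5⟩ := hword l h2 1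
    refine ⟨l', by rw [h3, h1], fun s hs => hF.mem_toFinset.mpr (hF₀F s (h4 s hs)), ?_⟩
    rw [h5]
    simp only [e, one_mul, (QuotientGroup.eq_one_iff _).mpr ht]
    rw [hcomm _ hr1 _ ht]; group

end Schreier

/-! ### Splitting a uniform part off a measure -/

section Minorization

open scoped Pointwise

variable {G : Type*} [Group G] [MeasurableSpace G] [DiscreteMeasurableSpace G] [Countable G]

lemma mul_mem_atoms_mconv {ν₁ ν₂ : Measure G} [IsFiniteMeasure ν₁] [IsFiniteMeasure ν₂] {g h : G}
    (hg : g ∈ atoms ν₁) (hh : h ∈ atoms ν₂) : g * h ∈ atoms (ν₁.mconv ν₂) := by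
  have h1 : ν₁ {g} * ν₂ {h} ≤ (ν₁.mconv ν₂) {g * h} := by
    rw [Measure.mconv, Measure.map_apply Measurable.of_discrete (MeasurableSet.singleton _),
      ← Measure.prod_prod]
    refine measure_mono ?_
    rintro ⟨a, b⟩ ⟨ha, hb⟩
    simp_all
  exact fun h0 => mul_ne_zero hg hh (le_antisymm (h1.trans h0.le) zero_le)

lemma atoms_pow_subset (ν : Measure G) [IsFiniteMeasure ν] (n : ℕ) :
    atoms ν ^ n ⊆ atoms (convPower ν n) := by
  induction n with
  | zero => simp [atoms, convPower]
  | succ n ih =>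
    rw [pow_succ]
    rintro _ ⟨g, hg, h, hh, rfl⟩
    exact mul_mem_atoms_mconv (ih hg) hh

lemma convPower_mono {ν₁ ν₂ : Measure G} [IsFiniteMeasure ν₁] [IsFiniteMeasure ν₂]
    (h : ν₁ ≤ ν₂) (n : ℕ) : convPower ν₁ n ≤ convPower ν₂ n := by
  induction n with
  | zero => exact le_rfl
  | succ n ih => exact Measure.map_mono (Measure.prod_mono ih h) Measurable.of_discrete

/-- A finite measure minus a multiple of the counting measure of a finite set. -/
lemma exists_eq_add_sum_dirac (ν : Measure G) [IsFiniteMeasure ν] {c : ℝ} {Q : Finset G}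
    (hQ : ∀ p ∈ Q, c ≤ ν.real {p}) :
    ∃ ν' : Measure G, IsFiniteMeasure ν' ∧
      ν = ν' + ∑ p ∈ Q, ENNReal.ofReal c • Measure.dirac p := by
  have hle : ∑ p ∈ Q, ENNReal.ofReal c • Measure.dirac p ≤ ν := by
    classical
    refine Measure.le_iff.mpr fun A hA => ?_
    calc (∑ p ∈ Q, ENNReal.ofReal c • Measure.dirac p) A
        = ∑ p ∈ Q, A.indicator (fun _ => ENNReal.ofReal c) p := by
          simp [Measure.dirac_apply' _ hA, Set.indicator_apply]
      _ ≤ ∑ p ∈ Q, A.indicator (fun p => ν {p}) p := by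
          refine Finset.sum_le_sum fun p hp => Set.indicator_le_indicator ?_
          exact ENNReal.ofReal_le_of_le_toReal (hQ p hp)
      _ = ∑ p ∈ Q.filter (· ∈ A), ν {p} := by
          rw [Finset.sum_filter]; simp [Set.indicator_apply]
      _ = ν (Q.filter (· ∈ A) : Finset G) := sum_measure_singleton
      _ ≤ ν A := measure_mono fun p hp => (Finset.mem_filter.mp hp).2
  have hf : IsFiniteMeasure (∑ p ∈ Q, ENNReal.ofReal c • Measure.dirac p) :=
    isFiniteMeasure_of_le ν hle
  exact ⟨ν - ∑ p ∈ Q, ENNReal.ofReal c • Measure.dirac p, inferInstance,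
    (Measure.sub_add_cancel_of_le hle).symm⟩

lemma real_univ_sum_dirac {c : ℝ} (hc : 0 ≤ c) (Q : Finset G) :
    (∑ p ∈ Q, ENNReal.ofReal c • Measure.dirac p : Measure G).real Set.univ = c * Q.card := by
  simp [Measure.real, ENNReal.toReal_ofReal hc, mul_comm]

variable {𝔸 : Type*} [NormedRing 𝔸] [NormedAlgebra ℝ 𝔸] [CompleteSpace 𝔸] {T : G →* 𝔸}

/-- Doeblin splitting: an atomic part of mass `c * Q.card`, uniform on `Q`, is separated from a
nonnegative remainder, so the remainder contributes an operator of norm at most `1 - c * Q.card`. -/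
lemma exists_avg_eq (hT : ∀ g, ‖T g‖ ≤ 1) (ν : Measure G) [IsProbabilityMeasure ν] {c : ℝ}
    (hc : 0 ≤ c) {Q : Finset G} (hQ : ∀ p ∈ Q, c ≤ ν.real {p}) :
    ∃ ν' : Measure G, IsFiniteMeasure ν' ∧ ν' ≤ ν ∧ ν'.real Set.univ = 1 - c * Q.card ∧
      avg T ν = c • ∑ p ∈ Q, T p + avg T ν' := by
  obtain ⟨ν', hf, h⟩ := exists_eq_add_sum_dirac ν hQ
  have hle : ∑ p ∈ Q, ENNReal.ofReal c • Measure.dirac p ≤ ν := by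
    rw [h]; exact Measure.le_add_left le_rfl
  have hf' : IsFiniteMeasure (∑ p ∈ Q, ENNReal.ofReal c • Measure.dirac p) :=
    isFiniteMeasure_of_le ν hle
  refine ⟨ν', hf, ?_, ?_, ?_⟩
  · rw [h]; exact Measure.le_add_right le_rfl
  · have h1 : ν.real Set.univ = 1 := by simp
    rw [h, measureReal_add_apply, real_univ_sum_dirac hc] at h1
    linarith
  · conv_lhs => rw [h]
    rw [avg_add hT, add_comm]
    congr 1
    rw [avg, integral_finsetSum_measure, Finset.smul_sum]
    · refine Finset.sum_congr rfl fun p _ => ?_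
      rw [integral_smul_measure, integral_dirac, ENNReal.toReal_ofReal hc]
    · intro p _
      exact (integrable_rep hT _).smul_measure (by simp)

end Minorization

/-! ### Lower bounds on atoms, uniform in the noise -/

section NoiseMinorization

open scoped Pointwise

variable {Γ : Type*} [Group Γ] [MeasurableSpace Γ] [DiscreteMeasurableSpace Γ] [Countable Γ]

/-- For `ρ ≥ 1/2` the measure `π^ρ` dominates half of `μ × μ`, which no longer depends on `ρ`; its
`L`-th power charges every point of the finite set. -/
lemma exists_le_convPower_noiseMeasure (μ : Measure Γ) [IsProbabilityMeasure μ] {L : ℕ}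
    {F : Finset Γ} (hF : ∀ f ∈ F, f ∈ atoms μ ^ L) :
    ∃ c : ℝ, 0 < c ∧ ∀ ρ : ℝ, 1 / 2 ≤ ρ → ∀ p ∈ F ×ˢ F,
      c ≤ (convPower (noiseMeasure μ ρ) L).real {p} := by
  set κ : Measure (Γ × Γ) := ENNReal.ofReal (1 / 2) • μ.prod μ with hκ
  have hκf : IsFiniteMeasure κ := Measure.smul_finite _ (by simp)
  have hpos : ∀ p ∈ F ×ˢ F, 0 < (convPower κ L).real {p} := by
    rintro ⟨f, f'⟩ hp
    rw [Finset.mem_product] at hp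
    have h1 : (f, f') ∈ (atoms μ ^ L) ×ˢ (atoms μ ^ L) := ⟨hF f hp.1, hF f' hp.2⟩
    rw [← Set.prod_pow] at h1
    have h2 : atoms μ ×ˢ atoms μ ⊆ atoms κ := by
      rintro ⟨a, b⟩ ⟨ha, hb⟩
      simp only [atoms, Set.mem_ofPred_eq] at ha hb
      simp [atoms, hκ, ← Set.singleton_prod_singleton, ha, hb]
    have h3 := atoms_pow_subset κ L (Set.pow_subset_pow_left h2 h1)
    exact ENNReal.toReal_pos h3 (measure_ne_top _ _)
  have hle : ∀ ρ : ℝ, 1 / 2 ≤ ρ → κ ≤ noiseMeasure μ ρ := fun ρ hρ => by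
    refine (Measure.le_iff.mpr fun A _ => ?_ : κ ≤ ENNReal.ofReal ρ • μ.prod μ).trans
      (Measure.le_add_right le_rfl)
    simp only [hκ, Measure.smul_apply, smul_eq_mul]
    gcongr
  have hmono : ∀ ρ : ℝ, 1 / 2 ≤ ρ → ∀ p,
      (convPower κ L).real {p} ≤ (convPower (noiseMeasure μ ρ) L).real {p} := fun ρ hρ p =>
    ENNReal.toReal_mono (measure_ne_top _ _) (convPower_mono (hle ρ hρ) L _)
  rcases (F ×ˢ F).eq_empty_or_nonempty with h0 | hne
  · exact ⟨1, one_pos, fun ρ _ p hp => by simp [h0] at hp⟩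
  · obtain ⟨p₀, hp₀, hmin⟩ := Finset.exists_min_image (F ×ˢ F) (fun p => (convPower κ L).real {p}) hne
    exact ⟨_, hpos p₀ hp₀, fun ρ hρ p hp => (hmin p hp).trans (hmono ρ hρ p)⟩

end NoiseMinorization

/-! ### Gradient estimates in abelian directions -/

section AbelianPart

variable {Γ : Type*} [Group Γ] {𝔸 : Type*} [NormedRing 𝔸] [NormedAlgebra ℝ 𝔸]

/-- Subadditivity along a word, from `1 - R(st) = (1 - R s) R t + (1 - R t)`; the factor `R t` is
moved past `z` and dropped as a contraction. -/
lemma norm_mul_one_sub_list_prod_mul_le {R : Γ →* 𝔸} (hR : ∀ g, ‖R g‖ ≤ 1) {X z : 𝔸}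
    (hz : ∀ g, Commute (R g) z) {F : Finset Γ} {M : ℝ}
    (hM : ∀ s ∈ F, ‖X * ((1 - R s) * z)‖ ≤ M) (l : List Γ) (hl : ∀ s ∈ l, s ∈ F) :
    ‖X * ((1 - R l.prod) * z)‖ ≤ l.length * M := by
  induction l with
  | nil => simp
  | cons s l ih =>
    have h1 : X * ((1 - R (s :: l).prod) * z) =
        X * ((1 - R s) * z) * R l.prod + X * ((1 - R l.prod) * z) := by
      rw [List.prod_cons, map_mul, mul_assoc X ((1 - R s) * z), mul_assoc (1 - R s),
        ← (hz l.prod).eq]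
      noncomm_ring
    have h2 := ih fun x hx => hl x (by simp [hx])
    have h3 := hM s (hl s (by simp))
    rw [h1, List.length_cons]
    push_cast
    calc _ ≤ ‖X * ((1 - R s) * z)‖ * ‖R l.prod‖ + ‖X * ((1 - R l.prod) * z)‖ :=
          (norm_add_le _ _).trans (by gcongr; exact norm_mul_le _ _)
      _ ≤ M * 1 + l.length * M := by
          gcongr
          · exact (norm_nonneg _).trans h3
          · exact hR _
      _ = _ := by ring

/-- The smoothing estimate for the uniform average over a finite commuting set. -/
lemma norm_uniform_pow_mul_one_sub_le [NormOneClass 𝔸] {R : Γ →* 𝔸} (hR : ∀ g, ‖R g‖ ≤ 1)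
    {F : Finset Γ} (h1 : 1 ∈ F) (hF : ∀ a ∈ F, ∀ b ∈ F, a * b = b * a) {s : Γ} (hs : s ∈ F)
    (j : ℕ) :
    ‖((F.card : ℝ)⁻¹ • ∑ f ∈ F, R f) ^ j * (1 - R s)‖ ≤ F.card / √(j + 1) := by
  classical
  by_cases h : s = 1
  · simp only [h, map_one, sub_self, mul_zero, norm_zero]; positivity
  have hcard : (2 : ℝ) ≤ F.card := by
    exact_mod_cast Finset.one_lt_card.mpr ⟨s, hs, 1, h1, h⟩
  have hsub : ({1, s} : Finset Γ) ⊆ F := by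
    intro x hx
    rcases Finset.mem_insert.mp hx with rfl | hx
    · exact h1
    · rwa [Finset.mem_singleton.mp hx]
  have hpair : ({1, s} : Finset Γ).card = 2 := Finset.card_pair (Ne.symm h)
  -- The pair `{1, s}` provides the lazy part `1 + R s`; the other terms form a commuting remainder.
  have hdec : (F.card : ℝ)⁻¹ • ∑ f ∈ F, R f =
      (F.card : ℝ)⁻¹ • (1 + R s) + (F.card : ℝ)⁻¹ • ∑ f ∈ F \ {1, s}, R f := by
    rw [← smul_add, ← Finset.sum_sdiff hsub, Finset.sum_pair (Ne.symm h), map_one, add_comm]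
  rw [hdec]
  have h2 : ‖(F.card : ℝ)⁻¹ • ∑ f ∈ F \ {1, s}, R f‖ ≤ 1 - 2 * (F.card : ℝ)⁻¹ := by
    have h3 : ‖∑ f ∈ F \ {1, s}, R f‖ ≤ F.card - 2 := by
      refine (norm_sum_le_of_le _ fun f _ => hR f).trans (le_of_eq ?_)
      rw [Finset.sum_const, Finset.card_sdiff_of_subset hsub, hpair, nsmul_eq_mul, mul_one,
        Nat.cast_sub (by exact_mod_cast hcard)]
      norm_num
    rw [norm_smul, Real.norm_of_nonneg (by positivity)]
    calc _ ≤ (F.card : ℝ)⁻¹ * (F.card - 2) := by gcongr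
      _ = _ := by field_simp
  have h4 := norm_smul_one_add_add_pow_mul_le (c := (F.card : ℝ)⁻¹) (by positivity)
    (by rw [← div_eq_mul_inv, div_le_one (by positivity)]; exact hcard) (hR s)
    ((Commute.sum_right _ _ _ fun f hf => by
      rw [commute_iff_eq, ← map_mul, ← map_mul, hF s hs f (Finset.mem_sdiff.mp hf).1]).smul_right _)
    h2 j
  simpa using h4

variable [MeasurableSpace Γ] [DiscreteMeasurableSpace Γ] [Countable Γ] [CompleteSpace 𝔸]
  [NormOneClass 𝔸] {T : Γ × Γ →* 𝔸}

lemma commute_sum_of_conj_mem {R : Γ →* 𝔸} {F : Finset Γ}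
    (hF : ∀ g, ∀ f ∈ F, g * f * g⁻¹ ∈ F) (g : Γ) : Commute (R g) (∑ f ∈ F, R f) := by
  rw [commute_iff_eq, Finset.mul_sum, Finset.sum_mul]
  refine Finset.sum_bij' (fun f _ => g * f * g⁻¹) (fun f _ => g⁻¹ * f * g)
    (fun f hf => hF g f hf) (fun f hf => by simpa using hF g⁻¹ f hf) ?_ ?_ ?_
  · intro f _; group
  · intro f _; group
  · intro f _
    rw [← map_mul, ← map_mul]; group

/-- The uniform part on `F ×ˢ F` averages to a multiple of `b₁ * b₂`. The two commuting coordinates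
each contribute `1/√(j+1)`, whence `1/(j+1)`. Conjugation invariance of `F` makes `b₁ * b₂` commute
with all `T p`, so the decay survives the addition of the unknown remainder. -/
lemma norm_avg_pow_mul_le_of_mem (hT : ∀ g, ‖T g‖ ≤ 1) {ν : Measure (Γ × Γ)}
    [IsProbabilityMeasure ν] {F : Finset Γ} (h1 : 1 ∈ F)
    (hcomm : ∀ a ∈ F, ∀ b ∈ F, a * b = b * a) (hconj : ∀ g, ∀ f ∈ F, g * f * g⁻¹ ∈ F) {c : ℝ}
    (hc : 0 < c) (hν : ∀ p ∈ F ×ˢ F, c ≤ ν.real {p}) {s s' : Γ} (hs : s ∈ F) (hs' : s' ∈ F)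
    (k : ℕ) :
    ‖avg T ν ^ k * ((1 - T (s, 1)) * (1 - T (1, s')))‖ ≤ c⁻¹ / (k + 1) := by
  set R₁ := T.comp (MonoidHom.inl Γ Γ) with hR₁
  set R₂ := T.comp (MonoidHom.inr Γ Γ) with hR₂
  have hT₁ : ∀ g, ‖R₁ g‖ ≤ 1 := fun g => hT _
  have hT₂ : ∀ g, ‖R₂ g‖ ≤ 1 := fun g => hT _
  have hT12 : ∀ g h, T (g, h) = R₁ g * R₂ h := fun g h => by
    simp [hR₁, hR₂, ← map_mul]
  have hR : ∀ g h, Commute (R₁ g) (R₂ h) := commute_inl_inr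
  obtain ⟨ν', hf, -, hm, havg⟩ := exists_avg_eq hT ν hc.le hν
  set b₁ := (F.card : ℝ)⁻¹ • ∑ f ∈ F, R₁ f with hb₁
  set b₂ := (F.card : ℝ)⁻¹ • ∑ f ∈ F, R₂ f with hb₂
  have hcard : (0 : ℝ) < F.card := by exact_mod_cast Finset.card_pos.mpr ⟨1, h1⟩
  have hb12 : Commute b₁ b₂ := ((Commute.sum_left _ _ _ fun f _ =>
    Commute.sum_right _ _ _ fun f' _ => hR f f').smul_left _).smul_right _
  have hb2s : ∀ s, Commute b₂ (1 - R₁ s) := fun s => (Commute.sum_left _ _ _ fun f _ =>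
    (Commute.one_right _).sub_right (hR s f).symm).smul_left _
  have hcen : ∀ p, Commute (b₁ * b₂) (T p) := by
    rintro ⟨g, h⟩
    rw [hT12]
    have e1 : Commute b₁ (R₁ g) := ((commute_sum_of_conj_mem hconj g).symm).smul_left _
    have e2 : Commute b₂ (R₂ h) := ((commute_sum_of_conj_mem hconj h).symm).smul_left _
    have e3 : Commute b₁ (R₂ h) := (Commute.sum_left _ _ _ fun f _ => hR f h).smul_left _
    have e4 : Commute b₂ (R₁ g) := (Commute.sum_left _ _ _ fun f _ => (hR g f).symm).smul_left _
    exact (e1.mul_right e3).mul_left (e4.mul_right e2)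
  have hmass : 0 ≤ 1 - c * ((F ×ˢ F).card : ℝ) := hm ▸ measureReal_nonneg
  have hcardp : ((F ×ˢ F).card : ℝ) = (F.card : ℝ) * F.card := by simp
  have hdec : avg T ν = (c * ((F.card : ℝ) * F.card)) • (b₁ * b₂) + avg T ν' := by
    rw [havg, hb₁, hb₂, smul_mul_smul_comm, smul_smul, Finset.sum_mul_sum, Finset.sum_product]
    congr 1
    simp only [hT12]
    congr 1
    field_simp
  rw [hcardp] at hmass hm
  rw [hdec]
  have hb : ∀ j : ℕ, ‖(b₁ * b₂) ^ j * ((1 - T (s, 1)) * (1 - T (1, s')))‖ ≤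
      ((F.card : ℝ) * F.card) / (j + 1) := by
    intro j
    have e1 : T (s, 1) = R₁ s := rfl
    have e2 : T (1, s') = R₂ s' := rfl
    have e3 : (b₁ * b₂) ^ j * ((1 - T (s, 1)) * (1 - T (1, s'))) =
        (b₁ ^ j * (1 - R₁ s)) * (b₂ ^ j * (1 - R₂ s')) := by
      rw [e1, e2, hb12.mul_pow, mul_assoc, mul_assoc, ← mul_assoc (b₂ ^ j),
        ((hb2s s).pow_left j).eq, mul_assoc]
    rw [e3]
    refine (norm_mul_le _ _).trans ?_
    refine (mul_le_mul (norm_uniform_pow_mul_one_sub_le hT₁ h1 hcomm hs j)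
      (norm_uniform_pow_mul_one_sub_le hT₂ h1 hcomm hs' j) (norm_nonneg _)
      (by positivity)).trans (le_of_eq ?_)
    rw [div_mul_div_comm, Real.mul_self_sqrt (by positivity)]
  refine (norm_smul_add_pow_mul_le_div (by positivity) (by linarith)
    (commute_avg hT hcen ν') ((norm_avg_le hT ν').trans hm.le) hb k).trans (le_of_eq ?_)
  field_simp

/-- The second order gradient estimate in the abelian directions. -/
lemma norm_avg_pow_mul_le_of_list (hT : ∀ g, ‖T g‖ ≤ 1) {ν : Measure (Γ × Γ)}
    [IsProbabilityMeasure ν] {F : Finset Γ} (h1 : 1 ∈ F)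
    (hcomm : ∀ a ∈ F, ∀ b ∈ F, a * b = b * a) (hconj : ∀ g, ∀ f ∈ F, g * f * g⁻¹ ∈ F) {c : ℝ}
    (hc : 0 < c) (hν : ∀ p ∈ F ×ˢ F, c ≤ ν.real {p}) {l l' : List Γ} (hl : ∀ s ∈ l, s ∈ F)
    (hl' : ∀ s ∈ l', s ∈ F) (k : ℕ) :
    ‖avg T ν ^ k * ((1 - T (l.prod, 1)) * (1 - T (1, l'.prod)))‖ ≤
      l.length * (l'.length * (c⁻¹ / (k + 1))) := by
  have hR : ∀ g h, Commute (T (g, 1)) (T (1, h)) := fun g h => by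
    simp [commute_iff_eq, ← map_mul]
  have hR' : ∀ g h, Commute (1 - T (g, 1)) (1 - T (1, h)) := fun g h =>
    ((Commute.one_right _).sub_right ((Commute.one_left _).sub_left (hR g h)))
  refine norm_mul_one_sub_list_prod_mul_le (R := T.comp (MonoidHom.inl Γ Γ)) (fun g => hT _)
    (fun g => (Commute.one_right _).sub_right (hR g _)) (fun s hs => ?_) l hl
  show ‖avg T ν ^ k * ((1 - T (s, 1)) * (1 - T (1, l'.prod)))‖ ≤ _
  rw [(hR' _ _).eq]
  refine norm_mul_one_sub_list_prod_mul_le (R := T.comp (MonoidHom.inr Γ Γ)) (fun g => hT _)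
    (fun g => (Commute.one_right _).sub_right (hR _ g).symm) (fun s' hs' => ?_) l' hl'
  show ‖avg T ν ^ k * ((1 - T (1, s')) * (1 - T (s, 1)))‖ ≤ _
  rw [← (hR' _ _).eq]
  exact norm_avg_pow_mul_le_of_mem hT h1 hcomm hconj hc hν hs hs' k

end AbelianPart

/-! ### Transversals and their permutations -/

section Transversal

variable {Γ : Type*} [Group Γ]

/-- Right multiplication by `n ∈ N` permutes the cosets of `A` in `N`; `σ r` is the representative
of the coset of `r * n`. -/
lemma exists_transversal (N A : Subgroup Γ) [A.Normal] [A.FiniteIndex] (hAN : A ≤ N) :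
    ∃ R : Finset Γ, R.Nonempty ∧ (∀ r ∈ R, r ∈ N) ∧ ∀ n ∈ N, ∃ σ : Γ → Γ,
      (∀ r ∈ R, σ r ∈ R) ∧ Set.InjOn σ R ∧ ∀ r ∈ R, r * n * (σ r)⁻¹ ∈ A := by
  classical
  have hfin : Finite (Γ ⧸ A) := inferInstance
  have hr : ∀ q : Γ ⧸ A, ((q.out : Γ) : Γ ⧸ A) = q := fun q => Quotient.out_eq q
  have hfR : {g : Γ | g ∈ N ∧ ∃ q : Γ ⧸ A, q.out = g}.Finite :=
    (Set.finite_range (Quotient.out : Γ ⧸ A → Γ)).subset fun g hg => hg.2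
  have hout : ∀ g ∈ N, ((g : Γ) : Γ ⧸ A).out ∈ N := fun g hg => by
    have h1 : g⁻¹ * ((g : Γ) : Γ ⧸ A).out ∈ A := QuotientGroup.eq.mp (hr _).symm
    simpa using N.mul_mem hg (hAN h1)
  refine ⟨hfR.toFinset, ⟨((1 : Γ) : Γ ⧸ A).out, ?_⟩, ?_, ?_⟩
  · exact hfR.mem_toFinset.mpr ⟨hout 1 N.one_mem, _, rfl⟩
  · exact fun r h => (hfR.mem_toFinset.mp h).1
  · intro n hn
    refine ⟨fun r => ((r * n : Γ) : Γ ⧸ A).out, fun r h => ?_, ?_, fun r _ => ?_⟩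
    · exact hfR.mem_toFinset.mpr ⟨hout _ (N.mul_mem (hfR.mem_toFinset.mp h).1 hn), _, rfl⟩
    · intro r h r' h' he
      obtain ⟨-, q, rfl⟩ := hfR.mem_toFinset.mp h
      obtain ⟨-, q', rfl⟩ := hfR.mem_toFinset.mp h'
      have h2 := congrArg (fun g : Γ => (g : Γ ⧸ A)) he
      simp only [hr, QuotientGroup.mk_mul, mul_left_inj] at h2
      rw [h2]
    · rw [← QuotientGroup.eq_one_iff]
      simp [hr]

lemma sum_comp_of_injOn {M : Type*} [AddCommMonoid M] {R : Finset Γ} {σ : Γ → Γ}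
    (hσ : ∀ r ∈ R, σ r ∈ R) (hinj : Set.InjOn σ R) (f : Γ → M) :
    ∑ r ∈ R, f (σ r) = ∑ r ∈ R, f r := by
  classical
  have h : R.image σ = R := Finset.eq_of_subset_of_card_le
    (Finset.image_subset_iff.mpr hσ) (Finset.card_image_of_injOn hinj).ge
  conv_rhs => rw [← h, Finset.sum_image hinj]

end Transversal

/-! ### A scalar recursion with rate `1/k` -/

section Recursion

/-- Of the gain `ε/2`, one half absorbs the inhomogeneous term and the other half pays for replacing
`k` by `k + 1`, which is possible once `k₀` exceeds `4/ε`. -/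
lemma recursion_le {ε C₁ C₂ k₀ : ℝ} (hε : 0 < ε) (hC₁ : 0 ≤ C₁)
    (hk₀ : 1 + 4 / ε ≤ k₀) (hC₂ : 4 * C₁ * k₀ / ε ≤ C₂) (k : ℕ) :
    C₁ / (k + 1) + (1 - ε / 2) * (C₂ / (k + k₀)) ≤ C₂ / ((k + 1 : ℕ) + k₀) := by
  have h4 : 0 < 4 / ε := by positivity
  have hk1 : 1 ≤ k₀ := by linarith
  have hk : (0 : ℝ) ≤ k := Nat.cast_nonneg k
  have hkk : 0 < (k : ℝ) + k₀ := by linarith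
  have hC2 : 0 ≤ C₂ := le_trans (by positivity) hC₂
  have e1 : C₁ / (k + 1) ≤ C₁ * k₀ / (k + k₀) := by
    rw [div_le_div_iff₀ (by positivity) hkk]
    nlinarith [mul_nonneg hC₁ (mul_nonneg hk (sub_nonneg.mpr hk1))]
  have e2 : (1 - ε / 4) * (C₂ / (k + k₀)) ≤ C₂ / ((k + 1 : ℕ) + k₀) := by
    push_cast
    rw [mul_div_assoc', div_le_div_iff₀ hkk (by positivity)]
    have : 1 ≤ ε / 4 * (k + 1 + k₀) := by
      have h5 : ε / 4 * (4 / ε) = 1 := by field_simp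
      nlinarith
    nlinarith [mul_nonneg hC2 (sub_nonneg.mpr this)]
  have e3 : C₁ * k₀ ≤ ε / 4 * C₂ := by
    rw [div_le_iff₀ hε] at hC₂; linarith
  have e4 : C₁ * k₀ / (k + k₀) ≤ ε / 4 * (C₂ / (k + k₀)) := by
    rw [mul_div_assoc']; gcongr
  linarith

end Recursion

/-! ### Second order gradient estimates in the directions of `N` -/

section SecondOrder

variable {Γ : Type*} [Group Γ] {𝔸 : Type*} [NormedRing 𝔸] [NormedAlgebra ℝ 𝔸]

/-- The second order difference in the direction `(m, n)`. -/
def mixedDiff (T : Γ × Γ →* 𝔸) (m n : Γ) : 𝔸 := (1 - T (m, 1)) * (1 - T (1, n))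

variable {T : Γ × Γ →* 𝔸}

lemma mul_mixedDiff (y : Γ × Γ) (m n : Γ) :
    T y * mixedDiff T m n = mixedDiff T (y.1 * m * y.1⁻¹) (y.2 * n * y.2⁻¹) * T y := by
  have h : ∀ p, T y * (1 - T p) = (1 - T (y * p * y⁻¹)) * T y := fun p => by
    rw [mul_sub, sub_mul, ← map_mul, ← map_mul]
    simp
  have e1 : y * (m, 1) * y⁻¹ = (y.1 * m * y.1⁻¹, 1) := by ext <;> simp
  have e2 : y * (1, n) * y⁻¹ = (1, y.2 * n * y.2⁻¹) := by ext <;> simp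
  rw [mixedDiff, mixedDiff, ← mul_assoc, h, mul_assoc _ (T y), h, e1, e2, ← mul_assoc]

lemma commute_T_inl_inr (g h : Γ) : Commute (T (g, 1)) (T (1, h)) := by
  simp [commute_iff_eq, ← map_mul]

/-- Reindexing the first sum in `∑ T(r) - ∑ T(r m)` by `σ` pairs `σ r` with `r m = (r m (σ r)⁻¹) (σ
r)`. For a transversal this replaces a direction in `N` by directions in `A`. -/
lemma sum_mul_mixedDiff {R : Finset Γ} {m n : Γ} {σ τ : Γ → Γ} (hσ : ∀ r ∈ R, σ r ∈ R)
    (hσi : Set.InjOn σ R) (hτ : ∀ r ∈ R, τ r ∈ R) (hτi : Set.InjOn τ R) :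
    (∑ p ∈ R ×ˢ R, T p) * mixedDiff T m n = ∑ p ∈ R ×ˢ R,
      mixedDiff T (p.1 * m * (σ p.1)⁻¹) (p.2 * n * (τ p.2)⁻¹) * T (σ p.1, τ p.2) := by
  have h1 : (∑ r ∈ R, T (r, 1)) * (1 - T (m, 1)) =
      ∑ r ∈ R, (1 - T (r * m * (σ r)⁻¹, 1)) * T (σ r, 1) := by
    rw [mul_sub, mul_one, Finset.sum_mul, ← sum_comp_of_injOn hσ hσi (fun r => T (r, 1)),
      ← Finset.sum_sub_distrib]
    refine Finset.sum_congr rfl fun r _ => ?_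
    rw [sub_mul, one_mul, ← map_mul, ← map_mul]
    simp
  have h2 : (∑ r ∈ R, T (1, r)) * (1 - T (1, n)) =
      ∑ r ∈ R, (1 - T (1, r * n * (τ r)⁻¹)) * T (1, τ r) := by
    rw [mul_sub, mul_one, Finset.sum_mul, ← sum_comp_of_injOn hτ hτi (fun r => T (1, r)),
      ← Finset.sum_sub_distrib]
    refine Finset.sum_congr rfl fun r _ => ?_
    rw [sub_mul, one_mul, ← map_mul, ← map_mul]
    simp
  have h3 : ∑ p ∈ R ×ˢ R, T p = (∑ r ∈ R, T (r, 1)) * ∑ r ∈ R, T (1, r) := by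
    rw [Finset.sum_mul_sum, Finset.sum_product]
    simp [← map_mul]
  have hc : ∀ g h, Commute (T (g, 1)) (1 - T (1, h)) := fun g h =>
    (Commute.one_right _).sub_right (commute_T_inl_inr g h)
  have hc2 : Commute (∑ r ∈ R, T (1, r)) (1 - T (m, 1)) := Commute.sum_left _ _ _ fun r _ =>
    (Commute.one_right _).sub_right (commute_T_inl_inr m r).symm
  rw [h3, mixedDiff, mul_assoc, ← mul_assoc (∑ r ∈ R, T (1, r)), hc2.eq, mul_assoc, h2,
    ← mul_assoc, h1, Finset.sum_mul_sum, Finset.sum_product]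
  refine Finset.sum_congr rfl fun r _ => Finset.sum_congr rfl fun r' _ => ?_
  rw [mixedDiff, mul_assoc, ← mul_assoc (T (σ r, 1)), (hc _ _).eq]
  simp [mul_assoc, ← map_mul]

lemma norm_mixedDiff_le [NormOneClass 𝔸] (hT : ∀ g, ‖T g‖ ≤ 1) (m n : Γ) :
    ‖mixedDiff T m n‖ ≤ 4 := by
  have h : ∀ p, ‖1 - T p‖ ≤ 2 := fun p => by
    refine (norm_sub_le _ _).trans ?_
    rw [norm_one]
    linarith [hT p]
  refine (norm_mul_le _ _).trans ?_
  nlinarith [h (m, 1), h (1, n), norm_nonneg (1 - T (m, 1)), norm_nonneg (1 - T (1, n))]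

variable [MeasurableSpace Γ] [DiscreteMeasurableSpace Γ] [Countable Γ] [CompleteSpace 𝔸]
  [NormOneClass 𝔸]

/-- Young's inequality for `(|n| + 2|y|)²`. The leading factor must be as close to `1` as desired,
so that lengthening by conjugation does not consume the contraction in the recursion. -/
lemma sq_wordLength_conj_le {S : Set Γ} (hS : Subgroup.closure S = ⊤) {κ : ℝ} (hκ : 0 < κ)
    (y n : Γ) : (wordLength S (y * n * y⁻¹) : ℝ) ^ 2 ≤
      (1 + κ) * (wordLength S n : ℝ) ^ 2 + 4 * (1 + 1 / κ) * (wordLength S y : ℝ) ^ 2 := by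
  have h1 : (wordLength S (y * n * y⁻¹) : ℝ) ≤ wordLength S n + 2 * wordLength S y := by
    have e1 := wordLength_mul_le hS (y * n) y⁻¹
    have e2 := wordLength_mul_le hS y n
    rw [wordLength_inv hS] at e1
    exact_mod_cast (by omega : wordLength S (y * n * y⁻¹) ≤ wordLength S n + 2 * wordLength S y)
  have h2 := pow_le_pow_left₀ (Nat.cast_nonneg _) h1 2
  refine h2.trans ?_
  generalize (wordLength S n : ℝ) = u
  generalize (wordLength S y : ℝ) = v
  have h3 : (1 + κ) * u ^ 2 + 4 * (1 + 1 / κ) * v ^ 2 - (u + 2 * v) ^ 2 =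
      (κ * u - 2 * v) ^ 2 / κ := by field_simp; ring
  have h4 : 0 ≤ (κ * u - 2 * v) ^ 2 / κ := by positivity
  linarith

lemma norm_mul_avg_mul_mixedDiff_le (hT : ∀ g, ‖T g‖ ≤ 1) {ν : Measure (Γ × Γ)}
    [IsFiniteMeasure ν] {X : 𝔸} {m n : Γ} {f : Γ × Γ → ℝ} (hf : Integrable f ν)
    (h : ∀ y : Γ × Γ, ‖X * mixedDiff T (y.1 * m * y.1⁻¹) (y.2 * n * y.2⁻¹)‖ ≤ f y) :
    ‖X * (avg T ν * mixedDiff T m n)‖ ≤ ∫ y, f y ∂ν := by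
  have hi : Integrable (fun y => T y * mixedDiff T m n) ν := (integrable_rep hT ν).mul_const _
  rw [avg_mul hT, ← integral_const_mul_of_integrable hi]
  refine norm_integral_le_of_norm_le hf (ae_of_all _ fun y => ?_)
  rw [mul_mixedDiff, ← mul_assoc]
  refine (norm_mul_le _ _).trans ?_
  exact (mul_le_of_le_one_right (norm_nonneg _) (hT _)).trans (h y)

set_option maxHeartbeats 1000000 in
/-- The second order gradient estimate for random walks on `Γ × Γ` in the directions of `N × N`. -/
lemma exists_norm_avg_pow_mul_mixedDiff_le (hT : ∀ g, ‖T g‖ ≤ 1) {S : Set Γ}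
    (hS : Subgroup.closure S = ⊤) {N A : Subgroup Γ} [hN : N.Normal]
    (hcomm : ∀ a ∈ A, ∀ b ∈ A, a * b = b * a) {F : Finset Γ} (hFA : ∀ f ∈ F, f ∈ A) (h1 : 1 ∈ F)
    (hconj : ∀ g, ∀ f ∈ F, g * f * g⁻¹ ∈ F)
    (hword : ∀ t ∈ A, ∃ l : List Γ, l.length ≤ wordLength S t ∧ (∀ s ∈ l, s ∈ F) ∧ l.prod = t)
    {R : Finset Γ} (hRne : R.Nonempty)
    (hR : ∀ n ∈ N, ∃ σ : Γ → Γ, (∀ r ∈ R, σ r ∈ R) ∧ Set.InjOn σ R ∧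
      ∀ r ∈ R, r * n * (σ r)⁻¹ ∈ A) {c M : ℝ} (hc : 0 < c) (hM : 0 ≤ M) :
    ∃ C a : ℝ, 0 ≤ C ∧ 0 ≤ a ∧ ∀ ν : Measure (Γ × Γ), IsProbabilityMeasure ν →
      (∀ p ∈ F ×ˢ F, c ≤ ν.real {p}) → (∀ p ∈ R ×ˢ R, c ≤ ν.real {p}) →
      Integrable (fun p => (wordLength S p.1 : ℝ) ^ 2 + (wordLength S p.2 : ℝ) ^ 2) ν →
      ∫ p, (wordLength S p.1 : ℝ) ^ 2 + (wordLength S p.2 : ℝ) ^ 2 ∂ν ≤ M →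
      ∀ k : ℕ, ∀ m ∈ N, ∀ n ∈ N, ‖avg T ν ^ k * mixedDiff T m n‖ ≤
        C / (k + 1) * (a + (wordLength S m : ℝ) ^ 2 + (wordLength S n : ℝ) ^ 2) := by
  set ε := c * ((R.card : ℝ) * R.card) with hεdef
  have hRc : (0 : ℝ) < R.card := by exact_mod_cast Finset.card_pos.mpr hRne
  have hε : 0 < ε := by positivity
  set w : ℝ := ((R.sup (wordLength S) : ℕ) : ℝ) with hw
  set C₁ := (R.card : ℝ) * R.card
  -- With this choice `(1 - ε)(1 + κ) ≤ 1 - ε/2`.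
  set κ := ε / 2 with hκdef
  have hκ : 0 < κ := by positivity
  set b := 4 * (1 + 1 / κ) * M
  have hb : 0 ≤ b := by positivity
  -- The three terms of `a` serve, in order, the base case `k = 0`, the lengthening by
  -- representatives in `R`, and the mean additive increase `b` of the squared lengths under
  -- conjugation: `b ≤ ε/2 * a`.
  set a := 1 + 8 * w ^ 2 + 2 * b / ε with hadef
  have ha1 : 1 ≤ a := by
    have : 0 ≤ 8 * w ^ 2 + 2 * b / ε := by positivity
    linarith
  have ha2 : 8 * w ^ 2 ≤ a := by
    have : 0 ≤ 2 * b / ε := by positivity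
    linarith
  have ha3 : b ≤ ε / 2 * a := by
    have h : ε / 2 * a = ε / 2 * (1 + 8 * w ^ 2) + b := by rw [hadef]; field_simp
    have : 0 ≤ ε / 2 * (1 + 8 * w ^ 2) := by positivity
    linarith
  clear_value a
  set k₀ := 1 + 4 / ε with hk₀
  have hk1 : 1 ≤ k₀ := by
    have : 0 < 4 / ε := by positivity
    linarith
  -- The first term covers `k = 0`, where a mixed difference has norm at most `4`; the second is
  -- what `recursion_le` requires.
  set C₂ := 4 * k₀ + 4 * C₁ * k₀ / ε with hC₂
  have hC₂0 : 0 ≤ C₂ := by positivity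
  refine ⟨C₂, a, hC₂0, by linarith, ?_⟩
  intro ν hν hνF hνR hint hintM
  obtain ⟨ν', hf, hle, hmass, havg⟩ := exists_avg_eq hT ν hc.le hνR
  rw [Finset.card_product, Nat.cast_mul, ← hεdef] at hmass
  have hε1 : ε ≤ 1 := by
    have : 0 ≤ ν'.real Set.univ := measureReal_nonneg
    linarith
  set V : Γ → Γ → ℝ := fun m n => a + (wordLength S m : ℝ) ^ 2 + (wordLength S n : ℝ) ^ 2 with hV
  have hVa : ∀ m n, a ≤ V m n := fun m n => by
    simp only [hV]; nlinarith [sq_nonneg (wordLength S m : ℝ), sq_nonneg (wordLength S n : ℝ)]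
  have hV0 : ∀ m n, 0 ≤ V m n := fun m n => by linarith [hVa m n]
  suffices h : ∀ k : ℕ, ∀ m ∈ N, ∀ n ∈ N,
      ‖avg T ν ^ k * mixedDiff T m n‖ ≤ C₂ / (k + k₀) * V m n by
    intro k m hm n hn
    refine (h k m hm n hn).trans ?_
    exact mul_le_mul_of_nonneg_right (by gcongr) (hV0 m n)
  intro k
  induction k with
  | zero =>
    intro m _ n _
    rw [pow_zero, one_mul]
    have h4 : 4 ≤ C₂ / ((0 : ℕ) + k₀) := by
      rw [Nat.cast_zero, zero_add, le_div_iff₀ (by linarith), hC₂]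
      have : 0 ≤ 4 * C₁ * k₀ / ε := by positivity
      linarith
    nlinarith [norm_mixedDiff_le hT m n, hVa m n]
  | succ k ih =>
    intro m hm n hn
    set X := avg T ν with hX
    -- The step adjacent to the difference is split: its part uniform on `R ×ˢ R` leads to
    -- directions in `A`, where the estimate is known; the remainder, of mass `1 - ε`, conjugates
    -- the directions and is treated by induction.
    have hsplit : X ^ (k + 1) * mixedDiff T m n =
        c • (X ^ k * ((∑ p ∈ R ×ˢ R, T p) * mixedDiff T m n)) +
          X ^ k * (avg T ν' * mixedDiff T m n) := by
      rw [← mul_smul_comm, ← smul_mul_assoc, ← mul_add, ← add_mul, ← havg, pow_succ, mul_assoc]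
    obtain ⟨σ, hσ, hσi, hσA⟩ := hR m hm
    obtain ⟨τ, hτ, hτi, hτA⟩ := hR n hn
    have hlen : ∀ (g : Γ) (σ : Γ → Γ), (∀ r ∈ R, σ r ∈ R) → ∀ r ∈ R,
        (wordLength S (r * g * (σ r)⁻¹) : ℝ) ≤ wordLength S g + 2 * w := by
      intro g σ hσ r hr
      have e1 := wordLength_mul_le hS (r * g) (σ r)⁻¹
      have e2 := wordLength_mul_le hS r g
      rw [wordLength_inv hS] at e1
      have e3 : wordLength S r ≤ R.sup (wordLength S) := Finset.le_sup hr
      have e4 : wordLength S (σ r) ≤ R.sup (wordLength S) := Finset.le_sup (hσ r hr)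
      have e5 : wordLength S (r * g * (σ r)⁻¹) ≤ wordLength S g + 2 * R.sup (wordLength S) := by
        omega
      rw [hw]; exact_mod_cast e5
    have hAA : ∀ t ∈ A, ∀ t' ∈ A, ‖X ^ k * mixedDiff T t t'‖ ≤
        (wordLength S t : ℝ) * ((wordLength S t' : ℝ) * (c⁻¹ / (k + 1))) := by
      intro t ht t' ht'
      obtain ⟨l, hl, hlF, rfl⟩ := hword t ht
      obtain ⟨l', hl', hlF', rfl⟩ := hword t' ht'
      refine (norm_avg_pow_mul_le_of_list hT h1
        (fun a ha b hb => hcomm a (hFA a ha) b (hFA b hb)) hconj hc hνF hlF hlF' k).trans ?_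
      have e1 : (l.length : ℝ) ≤ wordLength S l.prod := by exact_mod_cast hl
      have e2 : (l'.length : ℝ) ≤ wordLength S l'.prod := by exact_mod_cast hl'
      gcongr
    have hfirst : ‖c • (X ^ k * ((∑ p ∈ R ×ˢ R, T p) * mixedDiff T m n))‖ ≤
        C₁ / (k + 1) * V m n := by
      have hterm : ∀ p ∈ R ×ˢ R, ‖X ^ k * (mixedDiff T (p.1 * m * (σ p.1)⁻¹)
          (p.2 * n * (τ p.2)⁻¹) * T (σ p.1, τ p.2))‖ ≤ V m n * (c⁻¹ / (k + 1)) := by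
        rintro ⟨r, r'⟩ hp
        obtain ⟨hr, hr'⟩ := Finset.mem_product.mp hp
        rw [← mul_assoc]
        refine (norm_mul_le _ _).trans ?_
        refine (mul_le_of_le_one_right (norm_nonneg _) (hT _)).trans ?_
        refine (hAA _ (hσA r hr) _ (hτA r' hr')).trans ?_
        rw [← mul_assoc]
        refine mul_le_mul_of_nonneg_right ?_ (by positivity)
        have e1 := hlen m σ hσ r hr
        have e2 := hlen n τ hτ r' hr'
        refine (mul_le_mul e1 e2 (by positivity) (by positivity)).trans ?_
        simp only [hV]
        generalize (wordLength S m : ℝ) = u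
        generalize (wordLength S n : ℝ) = v
        nlinarith [sq_nonneg (u - v), sq_nonneg (u - 2 * w), sq_nonneg (v - 2 * w)]
      rw [sum_mul_mixedDiff hσ hσi hτ hτi, Finset.mul_sum, norm_smul, Real.norm_of_nonneg hc.le]
      refine (mul_le_mul_of_nonneg_left (norm_sum_le_of_le _ hterm) hc.le).trans (le_of_eq ?_)
      rw [Finset.sum_const, Finset.card_product, nsmul_eq_mul]
      push_cast
      show _ = (R.card : ℝ) * R.card / (k + 1) * V m n
      field_simp
    have hB : 0 ≤ C₂ / (k + k₀) := by positivity
    have hsecond : ‖X ^ k * (avg T ν' * mixedDiff T m n)‖ ≤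
        C₂ / (k + k₀) * ((1 - ε / 2) * V m n) := by
      have hint' : Integrable
          (fun p : Γ × Γ => (wordLength S p.1 : ℝ) ^ 2 + (wordLength S p.2 : ℝ) ^ 2) ν' :=
        hint.mono_measure hle
      have hgi : Integrable (fun y : Γ × Γ => C₂ / (k + k₀) * ((a + (1 + κ) *
          ((wordLength S m : ℝ) ^ 2 + (wordLength S n : ℝ) ^ 2)) + 4 * (1 + 1 / κ) *
            ((wordLength S y.1 : ℝ) ^ 2 + (wordLength S y.2 : ℝ) ^ 2))) ν' :=
        (((integrable_const _).add (hint'.const_mul _)).const_mul _)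
      refine (norm_mul_avg_mul_mixedDiff_le hT hgi fun y => ?_).trans ?_
      · refine (ih _ (hN.conj_mem m hm _) _ (hN.conj_mem n hn _)).trans ?_
        refine mul_le_mul_of_nonneg_left ?_ hB
        have e2 := sq_wordLength_conj_le hS hκ y.1 m
        have e3 := sq_wordLength_conj_le hS hκ y.2 n
        simp only [hV]
        linarith
      · rw [integral_const_mul, integral_add (integrable_const _) (hint'.const_mul _),
          integral_const_mul, integral_const, hmass, smul_eq_mul]
        refine mul_le_mul_of_nonneg_left ?_ hB
        have e4 : ∫ p, (wordLength S p.1 : ℝ) ^ 2 + (wordLength S p.2 : ℝ) ^ 2 ∂ν' ≤ M :=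
          (integral_mono_measure hle (ae_of_all _ fun p => by positivity) hint).trans hintM
        have e5 : 4 * (1 + 1 / κ) *
            ∫ p, (wordLength S p.1 : ℝ) ^ 2 + (wordLength S p.2 : ℝ) ^ 2 ∂ν' ≤ b :=
          mul_le_mul_of_nonneg_left e4 (by positivity)
        refine (add_le_add_right e5 _).trans ?_
        simp only [hV]
        have hq : 0 ≤ (wordLength S m : ℝ) ^ 2 + (wordLength S n : ℝ) ^ 2 := by positivity
        rw [add_assoc a]
        generalize (wordLength S m : ℝ) ^ 2 + (wordLength S n : ℝ) ^ 2 = q at *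
        have e6 : (1 - ε) * (1 + κ) ≤ 1 - ε / 2 := by rw [hκdef]; nlinarith
        nlinarith [mul_le_mul_of_nonneg_right e6 hq]
    rw [hsplit]
    refine (norm_add_le _ _).trans ((add_le_add hfirst hsecond).trans ?_)
    have h := recursion_le hε (C₁ := C₁) (by positivity) hk₀.ge (C₂ := C₂)
      (by rw [hC₂]; linarith) k
    calc _ = (C₁ / (k + 1) + (1 - ε / 2) * (C₂ / (k + k₀))) * V m n := by ring
      _ ≤ _ := mul_le_mul_of_nonneg_right h (hV0 m n)

end SecondOrder

/-! ### Moments and marginals of the walks -/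

section Moments

variable {Γ : Type*} [Group Γ] [MeasurableSpace Γ] [DiscreteMeasurableSpace Γ] [Countable Γ]

lemma ae_mem_atoms (μ : Measure Γ) : ∀ᵐ g ∂μ, g ∈ atoms μ := by
  rw [ae_iff, measure_null_iff_singleton (Set.to_countable _)]
  intro g hg
  simpa [atoms] using hg

lemma integrable_sq_wordLength_convPower {S : Set Γ} (hS : Subgroup.closure S = ⊤)
    {μ : Measure Γ} [IsProbabilityMeasure μ]
    (hμ : Integrable (fun g => (wordLength S g : ℝ) ^ 2) μ) (n : ℕ) :
    Integrable (fun g => (wordLength S g : ℝ) ^ 2) (convPower μ n) := by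
  induction n with
  | zero => exact integrable_dirac' .of_discrete (by simp)
  | succ n ih =>
    refine (integrable_map_measure .of_discrete Measurable.of_discrete.aemeasurable).mpr ?_
    refine (((ih.comp_fst μ).const_mul 2).add ((hμ.comp_snd (convPower μ n)).const_mul 2)).mono'
      .of_discrete (ae_of_all _ fun p => ?_)
    have h1 : (wordLength S (p.1 * p.2) : ℝ) ≤ wordLength S p.1 + wordLength S p.2 := by
      exact_mod_cast wordLength_mul_le hS p.1 p.2
    have h2 := pow_le_pow_left₀ (Nat.cast_nonneg _) h1 2
    simp only [Function.comp_apply, Pi.add_apply]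
    rw [Real.norm_of_nonneg (by positivity)]
    nlinarith [sq_nonneg ((wordLength S p.1 : ℝ) - wordLength S p.2)]

lemma map_convPower {G G' : Type*} [Group G] [Group G'] [MeasurableSpace G] [MeasurableSpace G']
    [DiscreteMeasurableSpace G] [DiscreteMeasurableSpace G'] [Countable G] [Countable G']
    (f : G →* G') (ν : Measure G) [IsFiniteMeasure ν] (n : ℕ) :
    (convPower ν n).map f = convPower (ν.map f) n := by
  induction n with
  | zero =>
    show (Measure.dirac (1 : G)).map f = Measure.dirac 1
    rw [Measure.map_dirac' Measurable.of_discrete, map_one]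
  | succ n ih =>
    show ((convPower ν n).mconv ν).map f = (convPower (ν.map f) n).mconv (ν.map f)
    rw [← ih]
    exact Measure.map_mconv_monoidHom f Measurable.of_discrete

lemma map_fst_noiseMeasure (μ : Measure Γ) [IsProbabilityMeasure μ] {ρ : ℝ} (h0 : 0 ≤ ρ)
    (h1 : ρ ≤ 1) : (noiseMeasure μ ρ).map Prod.fst = μ := by
  rw [noiseMeasure, Measure.map_add _ _ measurable_fst, Measure.map_smul, Measure.map_smul,
    Measure.map_map measurable_fst Measurable.of_discrete, Measure.map_fst_prod, measure_univ,
    one_smul, show Prod.fst ∘ (fun g : Γ => (g, g)) = id from rfl, Measure.map_id, ← add_smul,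
    ← ENNReal.ofReal_add h0 (by linarith)]
  simp

lemma map_snd_noiseMeasure (μ : Measure Γ) [IsProbabilityMeasure μ] {ρ : ℝ} (h0 : 0 ≤ ρ)
    (h1 : ρ ≤ 1) : (noiseMeasure μ ρ).map Prod.snd = μ := by
  rw [noiseMeasure, Measure.map_add _ _ measurable_snd, Measure.map_smul, Measure.map_smul,
    Measure.map_map measurable_snd Measurable.of_discrete, Measure.map_snd_prod, measure_univ,
    one_smul, show Prod.snd ∘ (fun g : Γ => (g, g)) = id from rfl, Measure.map_id, ← add_smul,
    ← ENNReal.ofReal_add h0 (by linarith)]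
  simp

lemma map_fst_convPower_noiseMeasure (μ : Measure Γ) [IsProbabilityMeasure μ] {ρ : ℝ}
    (h0 : 0 ≤ ρ) (h1 : ρ ≤ 1) (n : ℕ) :
    (convPower (noiseMeasure μ ρ) n).map Prod.fst = convPower μ n := by
  have h := map_convPower (MonoidHom.fst Γ Γ) (noiseMeasure μ ρ) n
  rwa [MonoidHom.coe_fst, map_fst_noiseMeasure μ h0 h1] at h

lemma map_snd_convPower_noiseMeasure (μ : Measure Γ) [IsProbabilityMeasure μ] {ρ : ℝ}
    (h0 : 0 ≤ ρ) (h1 : ρ ≤ 1) (n : ℕ) :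
    (convPower (noiseMeasure μ ρ) n).map Prod.snd = convPower μ n := by
  have h := map_convPower (MonoidHom.snd Γ Γ) (noiseMeasure μ ρ) n
  rwa [MonoidHom.coe_snd, map_snd_noiseMeasure μ h0 h1] at h

lemma integrable_sq_wordLength {S : Set Γ} {μ : Measure Γ}
    (hμ : ∫⁻ g, (wordLength S g : ℝ≥0∞) ^ 2 ∂μ < ∞) :
    Integrable (fun g => (wordLength S g : ℝ) ^ 2) μ := by
  refine ⟨.of_discrete, ?_⟩
  rw [HasFiniteIntegral]
  convert hμ using 3 with g
  rw [← ofReal_norm, Real.norm_of_nonneg (by positivity), ENNReal.ofReal_pow (by positivity),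
    ENNReal.ofReal_natCast]

end Moments

/-! ### The noise increment as an average of second order differences -/

section NoiseIncrement

variable {Γ : Type*} [Group Γ] [MeasurableSpace Γ] [DiscreteMeasurableSpace Γ] [Countable Γ]
  {𝔸 : Type*} [NormedRing 𝔸] [NormedAlgebra ℝ 𝔸] [CompleteSpace 𝔸] [NormOneClass 𝔸]

/-- The average of `T` with respect to the signed measure `μ_diag - μ × μ`. -/
noncomputable def noiseDiff (T : Γ × Γ →* 𝔸) (μ : Measure Γ) : 𝔸 :=
  avg (T.comp (diagHom Γ)) μ - avg T (μ.prod μ)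

variable {T : Γ × Γ →* 𝔸}

lemma mixedDiff_mul (g h h' : Γ) :
    mixedDiff T (g * h⁻¹) (g * h'⁻¹) * T (h, h') =
      T (h, h') - T (g, h') - T (h, g) + T (g, g) := by
  have e1 : T (g * h⁻¹, 1) * T (h, h') = T (g, h') := by simp [← map_mul]
  have e2 : T (1, g * h'⁻¹) * T (h, h') = T (h, g) := by simp [← map_mul]
  have e3 : T (g * h⁻¹, 1) * (T (1, g * h'⁻¹) * T (h, h')) = T (g, g) := by simp [← map_mul]
  have e4 : mixedDiff T (g * h⁻¹) (g * h'⁻¹) * T (h, h') = T (h, h') -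
      T (g * h⁻¹, 1) * T (h, h') - T (1, g * h'⁻¹) * T (h, h') +
        T (g * h⁻¹, 1) * (T (1, g * h'⁻¹) * T (h, h')) := by
    rw [mixedDiff]; noncomm_ring
  rw [e4, e3, e1, e2]

/-- For independent `g`, `h`, `h'` with law `μ`, the means of `T(h,h')`, `T(g,h')` and `T(h,g)` all
equal `avg T (μ.prod μ)`. In the four-term expansion of `mixedDiff_mul` their signs add up to `-1`,
and `T(g,g)` gives the diagonal part. -/
lemma noiseDiff_eq (hT : ∀ g, ‖T g‖ ≤ 1) (μ : Measure Γ) [IsProbabilityMeasure μ] :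
    noiseDiff T μ =
      ∫ g, ∫ p, mixedDiff T (g * p.1⁻¹) (g * p.2⁻¹) * T p ∂(μ.prod μ) ∂μ := by
  have hi : ∀ (ν : Measure (Γ × Γ)) [IsFiniteMeasure ν] (f : Γ × Γ → Γ × Γ),
      Integrable (fun x => T (f x)) ν :=
    fun ν _ f => Integrable.of_bound .of_discrete 1 (ae_of_all _ fun x => hT _)
  set R₁ := T.comp (MonoidHom.inl Γ Γ) with hR₁
  set R₂ := T.comp (MonoidHom.inr Γ Γ) with hR₂
  have hT₁ : ∀ g, ‖R₁ g‖ ≤ 1 := fun g => hT _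
  have hT₂ : ∀ g, ‖R₂ g‖ ≤ 1 := fun g => hT _
  have hT12 : ∀ g h, T (g, h) = R₁ g * R₂ h := fun g h => by
    simp [hR₁, hR₂, ← map_mul]
  have hinner : ∀ g, ∫ p, mixedDiff T (g * p.1⁻¹) (g * p.2⁻¹) * T p ∂(μ.prod μ) =
      avg T (μ.prod μ) - R₁ g * avg R₂ μ - avg R₁ μ * R₂ g + T (g, g) := by
    intro g
    have e : ∀ p : Γ × Γ, mixedDiff T (g * p.1⁻¹) (g * p.2⁻¹) * T p =
        T p - T (g, p.2) - T (p.1, g) + T (g, g) := fun p => mixedDiff_mul g p.1 p.2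
    simp only [e]
    have j1 : Integrable (fun p => T p) (μ.prod μ) := integrable_rep hT _
    have j2 : Integrable (fun p : Γ × Γ => T (g, p.2)) (μ.prod μ) := hi _ fun p => (g, p.2)
    have j3 : Integrable (fun p : Γ × Γ => T (p.1, g)) (μ.prod μ) := hi _ fun p => (p.1, g)
    have j4 : Integrable (fun p : Γ × Γ => T p - T (g, p.2)) (μ.prod μ) := j1.sub j2
    have j5 : Integrable (fun p : Γ × Γ => T p - T (g, p.2) - T (p.1, g)) (μ.prod μ) := j4.sub j3
    rw [integral_add j5 (integrable_const _), integral_sub j4 j3, integral_sub j1 j2,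
      integral_fun_snd (fun h => T (g, h)), integral_fun_fst (fun h => T (h, g)), integral_const,
      mul_avg hT₂, avg_mul hT₁]
    simp [avg, hT12]
  simp only [hinner]
  have i1 : Integrable (fun g => R₁ g * avg R₂ μ) μ := (integrable_rep hT₁ μ).mul_const _
  have i2 : Integrable (fun g => avg R₁ μ * R₂ g) μ := (integrable_rep hT₂ μ).const_mul _
  have i3 : Integrable (fun g => avg T (μ.prod μ) - R₁ g * avg R₂ μ) μ :=
    (integrable_const _).sub i1
  have i4 : Integrable (fun g => avg T (μ.prod μ) - R₁ g * avg R₂ μ - avg R₁ μ * R₂ g) μ :=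
    i3.sub i2
  have i5 : Integrable (fun g => T (g, g)) μ := Integrable.of_bound .of_discrete 1
    (ae_of_all _ fun g => hT _)
  rw [integral_add i4 i5, integral_sub i3 i2, integral_sub (integrable_const _) i1,
    ← avg_mul hT₁, ← mul_avg hT₂, integral_const, noiseDiff, avg_prod hT, ← hR₁, ← hR₂]
  simp [avg, diagHom]
  abel

/-- Atoms of `μ` lie in one coset of `N`, so only directions in `N` occur. The constant `8` comes
from `|g h⁻¹|² ≤ 2|g|² + 2|h|²`, applied to both directions and integrated. -/
lemma norm_mul_noiseDiff_le (hT : ∀ g, ‖T g‖ ≤ 1) {S : Set Γ} (hS : Subgroup.closure S = ⊤)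
    {μ : Measure Γ} [IsProbabilityMeasure μ]
    (hμ : Integrable (fun g => (wordLength S g : ℝ) ^ 2) μ) {N : Subgroup Γ}
    (hN : ∀ g ∈ atoms μ, ∀ h ∈ atoms μ, g * h⁻¹ ∈ N) {X : 𝔸} {K a : ℝ} (hK : 0 ≤ K)
    (hX : ∀ m ∈ N, ∀ n ∈ N, ‖X * mixedDiff T m n‖ ≤
      K * (a + (wordLength S m : ℝ) ^ 2 + (wordLength S n : ℝ) ^ 2)) :
    ‖X * noiseDiff T μ‖ ≤ K * (a + 8 * ∫ g, (wordLength S g : ℝ) ^ 2 ∂μ) := by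
  set q : Γ → ℝ := fun g => (wordLength S g : ℝ) ^ 2 with hq
  set I := ∫ g, q g ∂μ with hI
  have hqm : ∀ g h, q (g * h⁻¹) ≤ 2 * q g + 2 * q h := by
    intro g h
    have h1 : (wordLength S (g * h⁻¹) : ℝ) ≤ wordLength S g + wordLength S h := by
      have := wordLength_mul_le hS g h⁻¹
      rw [wordLength_inv hS] at this
      exact_mod_cast this
    have h2 := pow_le_pow_left₀ (Nat.cast_nonneg _) h1 2
    simp only [hq]
    nlinarith [sq_nonneg ((wordLength S g : ℝ) - wordLength S h)]
  have hi : ∀ g, Integrable (fun p => mixedDiff T (g * p.1⁻¹) (g * p.2⁻¹) * T p) (μ.prod μ) :=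
    fun g => Integrable.of_bound .of_discrete 4 (ae_of_all _ fun p => (norm_mul_le _ _).trans
      ((mul_le_of_le_one_right (norm_nonneg _) (hT _)).trans (norm_mixedDiff_le hT _ _)))
  have hi2 : Integrable
      (fun g => ∫ p, mixedDiff T (g * p.1⁻¹) (g * p.2⁻¹) * T p ∂(μ.prod μ)) μ := by
    refine Integrable.of_bound .of_discrete 4 (ae_of_all _ fun g => ?_)
    refine (norm_integral_le_of_norm_le_const (C := 4) (ae_of_all _ fun p =>
      (norm_mul_le _ _).trans ((mul_le_of_le_one_right (norm_nonneg _) (hT _)).trans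
        (norm_mixedDiff_le hT _ _)))).trans (by simp)
  have hq2 : Integrable (fun p : Γ × Γ => q p.1 + q p.2) (μ.prod μ) :=
    (hμ.comp_fst μ).add (hμ.comp_snd μ)
  have hq4 : Integrable (fun g => a + 4 * q g) μ := (integrable_const _).add (hμ.const_mul _)
  have hb1 : ∀ g, Integrable
      (fun p : Γ × Γ => K * (a + 4 * q g) + K * 2 * (q p.1 + q p.2)) (μ.prod μ) := fun g =>
    (integrable_const _).add (hq2.const_mul _)
  have hb2 : Integrable (fun g => K * (a + 4 * q g) + K * 2 * (I + I)) μ :=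
    (hq4.const_mul _).add (integrable_const _)
  rw [noiseDiff_eq hT, ← integral_const_mul_of_integrable hi2]
  refine (norm_integral_le_of_norm_le hb2 ?_).trans ?_
  · filter_upwards [ae_mem_atoms μ] with g hg
    rw [← integral_const_mul_of_integrable (hi g)]
    refine (norm_integral_le_of_norm_le (hb1 g) ?_).trans (le_of_eq ?_)
    · filter_upwards [Measure.quasiMeasurePreserving_fst.ae (ae_mem_atoms μ),
        Measure.quasiMeasurePreserving_snd.ae (ae_mem_atoms μ)] with p hp1 hp2
      rw [← mul_assoc]
      refine (norm_mul_le _ _).trans ((mul_le_of_le_one_right (norm_nonneg _) (hT _)).trans ?_)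
      refine (hX _ (hN g hg _ hp1) _ (hN g hg _ hp2)).trans ?_
      have h1 := hqm g p.1
      have h2 := hqm g p.2
      calc _ ≤ K * (a + (2 * q g + 2 * q p.1) + (2 * q g + 2 * q p.2)) := by
            gcongr
        _ = _ := by ring
    · rw [integral_add (integrable_const _) (hq2.const_mul _),
        integral_const_mul (K * 2), integral_add (hμ.comp_fst μ) (hμ.comp_snd μ),
        integral_fun_fst q, integral_fun_snd q]
      simp [hI]
  · rw [integral_add (hq4.const_mul _) (integrable_const _),
      integral_const_mul, integral_add (integrable_const _) (hμ.const_mul _), integral_const_mul]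
    simp only [integral_const, probReal_univ, smul_eq_mul, one_mul]
    apply le_of_eq
    ring

/-- The main estimate: a noise increment at the end of the walk is of order `1 / k`. -/
lemma exists_norm_avg_noiseMeasure_pow_mul_le (hΓ : IsVirtuallyAbelian Γ) {μ : Measure Γ}
    [IsProbabilityMeasure μ] (hμ₂ : HasFiniteSecondMoment μ) (hμ : SupportGenerates μ)
    (hT : ∀ g, ‖T g‖ ≤ 1) :
    ∃ K : ℝ, 0 ≤ K ∧ ∀ ρ : ℝ, 1 / 2 ≤ ρ → ρ ≤ 1 → ∀ k : ℕ,
      ‖avg T (noiseMeasure μ ρ) ^ k * noiseDiff T μ‖ ≤ K / (k + 1) := by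
  classical
  obtain ⟨S, hSf, hS, hmom⟩ := hμ₂
  have hint := integrable_sq_wordLength hmom
  obtain ⟨N, hNn, hNf, hN, hpow⟩ := exists_period_subgroup hμ
  obtain ⟨A, hAn, hAf, hAN, hcomm, F, hFA, h1, hconj, hword⟩ :=
    exists_abelian_normal_undistorted hΓ hSf hS N
  obtain ⟨R, hRne, hRN, hR⟩ := exists_transversal N A hAN
  obtain ⟨L, hL, hFR⟩ := hpow (F ∪ R) fun f hf => by
    rcases Finset.mem_union.mp hf with h | h
    exacts [hAN (hFA f h), hRN f h]
  obtain ⟨c, hc, hcν⟩ := exists_le_convPower_noiseMeasure μ hFR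
  have hintL := integrable_sq_wordLength_convPower hS hint L
  obtain ⟨C, a, hC, ha, hmain⟩ := exists_norm_avg_pow_mul_mixedDiff_le hT hS (N := N) hcomm hFA h1
    hconj hword hRne hR hc
    (M := (∫ g, (wordLength S g : ℝ) ^ 2 ∂convPower μ L) +
      ∫ g, (wordLength S g : ℝ) ^ 2 ∂convPower μ L)
    (by have : 0 ≤ ∫ g, (wordLength S g : ℝ) ^ 2 ∂convPower μ L :=
          integral_nonneg fun g => by positivity
        linarith)
  have hI : 0 ≤ ∫ g, (wordLength S g : ℝ) ^ 2 ∂μ := integral_nonneg fun g => by positivity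
  refine ⟨C * L * (a + 8 * ∫ g, (wordLength S g : ℝ) ^ 2 ∂μ), by positivity, ?_⟩
  intro ρ hρ hρ1 k
  have hπ := isProbabilityMeasure_noiseMeasure μ (by linarith : 0 ≤ ρ) hρ1
  have hfst := map_fst_convPower_noiseMeasure μ (by linarith : 0 ≤ ρ) hρ1 L
  have hsnd := map_snd_convPower_noiseMeasure μ (by linarith : 0 ≤ ρ) hρ1 L
  have hi1 : Integrable (fun p : Γ × Γ => (wordLength S p.1 : ℝ) ^ 2)
      (convPower (noiseMeasure μ ρ) L) := by
    rw [← hfst] at hintL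
    exact hintL.comp_measurable measurable_fst
  have hi2 : Integrable (fun p : Γ × Γ => (wordLength S p.2 : ℝ) ^ 2)
      (convPower (noiseMeasure μ ρ) L) := by
    rw [← hsnd] at hintL
    exact hintL.comp_measurable measurable_snd
  -- The gradient estimate is applied to blocks of `L` steps. Their second moment is independent of
  -- `ρ`, since both marginals are `μ_L`.
  have hblock := hmain (convPower (noiseMeasure μ ρ) L) inferInstance
    (fun p hp => hcν ρ hρ p (Finset.product_subset_product Finset.subset_union_left
      Finset.subset_union_left hp))
    (fun p hp => hcν ρ hρ p (Finset.product_subset_product Finset.subset_union_right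
      Finset.subset_union_right hp))
    (hi1.add hi2) (le_of_eq (by
      rw [integral_add hi1 hi2]
      congr 1
      · rw [← hfst, integral_map measurable_fst.aemeasurable .of_discrete]
      · rw [← hsnd, integral_map measurable_snd.aemeasurable .of_discrete]))
  rw [avg_convPower hT] at hblock
  set P := avg T (noiseMeasure μ ρ)
  have hP : ‖P‖ ≤ 1 := (norm_avg_le hT _).trans (by simp)
  have hk : (C / ((k / L : ℕ) + 1)) ≤ C * L / (k + 1) := by
    rw [div_le_div_iff₀ (by positivity) (by positivity), mul_assoc]
    refine mul_le_mul_of_nonneg_left ?_ hC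
    have := Nat.lt_mul_div_succ k hL
    exact_mod_cast (by linarith [this] : k + 1 ≤ L * (k / L + 1))
  refine (norm_mul_noiseDiff_le hT hS hint hN (X := P ^ k) (K := C * L / (k + 1)) (a := a)
    (by positivity) fun m hm n hn => ?_).trans (le_of_eq (by ring))
  -- The `k % L` steps outside complete blocks are on the far side of the difference and are dropped
  -- as contractions.
  have hsplit : P ^ k * mixedDiff T m n = P ^ (k % L) * ((P ^ L) ^ (k / L) * mixedDiff T m n) := by
    rw [← mul_assoc, ← pow_mul, ← pow_add, Nat.mod_add_div]
  rw [hsplit]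
  refine (norm_mul_le _ _).trans ((mul_le_of_le_one_left (norm_nonneg _)
    ((norm_pow_le _ _).trans (pow_le_one₀ (norm_nonneg _) hP))).trans ?_)
  exact (hblock (k / L) m hm n hn).trans (mul_le_mul_of_nonneg_right hk (by positivity))

end NoiseIncrement

/-! ### Time reversal through the opposite algebra -/

section Opposite

variable {Γ : Type*} [Group Γ] [MeasurableSpace Γ] [DiscreteMeasurableSpace Γ] [Countable Γ]

lemma atoms_map_inv (μ : Measure Γ) : atoms (μ.map Inv.inv) = (atoms μ)⁻¹ := by
  ext g
  have h : Inv.inv ⁻¹' {g} = ({g⁻¹} : Set Γ) := by ext x; simp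
  simp [atoms, Measure.map_apply Measurable.of_discrete (MeasurableSet.singleton g), h]

lemma SupportGenerates.map_inv {μ : Measure Γ} (h : SupportGenerates μ) :
    SupportGenerates (μ.map Inv.inv) := by
  rw [SupportGenerates, atoms_map_inv, eq_top_iff]
  intro g _
  have hall : ∀ x ∈ Subsemigroup.closure (atoms μ),
      x⁻¹ ∈ Subsemigroup.closure (atoms μ)⁻¹ := by
    intro x hx
    induction hx using Subsemigroup.closure_induction with
    | mem x hx => exact Subsemigroup.subset_closure (by simpa using hx)
    | mul x y _ _ hx hy => rw [mul_inv_rev]; exact mul_mem hy hx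
  have h' : Subsemigroup.closure (atoms μ) = ⊤ := h
  simpa using hall g⁻¹ (by rw [h']; trivial)

lemma HasFiniteSecondMoment.map_inv {μ : Measure Γ} (h : HasFiniteSecondMoment μ) :
    HasFiniteSecondMoment (μ.map Inv.inv) := by
  obtain ⟨S, hSf, hS, hm⟩ := h
  refine ⟨S, hSf, hS, ?_⟩
  rw [lintegral_map Measurable.of_discrete Measurable.of_discrete]
  simpa only [wordLength_inv hS] using hm

variable {𝔸 : Type*} [NormedRing 𝔸] [NormedAlgebra ℝ 𝔸] [CompleteSpace 𝔸]

/-- The representation in the opposite algebra associated with a representation. -/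
def oppositeRep {G : Type*} [Group G] {𝔸 : Type*} [Monoid 𝔸] (T : G →* 𝔸) : G →* 𝔸ᵐᵒᵖ where
  toFun g := MulOpposite.op (T g⁻¹)
  map_one' := by simp
  map_mul' g h := by simp [← MulOpposite.op_mul, ← map_mul]

lemma avg_oppositeRep {G : Type*} [Group G] [MeasurableSpace G] [DiscreteMeasurableSpace G]
    [Countable G] {T : G →* 𝔸} (ν : Measure G) :
    avg (oppositeRep T) (ν.map Inv.inv) = MulOpposite.op (avg T ν) := by
  rw [avg, integral_map Measurable.of_discrete.aemeasurable .of_discrete]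
  have h := (MulOpposite.opContinuousLinearEquiv ℝ (M := 𝔸)).integral_comp_comm (μ := ν)
    (fun g => T g)
  simpa [oppositeRep, avg] using h

variable [NormOneClass 𝔸] {T : Γ × Γ →* 𝔸}

/-- Passing to inverses and to the opposite algebra reverses products, so this is the preceding
estimate for the reflected measure at `ρ = 1`, where `π^ρ` is the product measure. -/
lemma exists_norm_noiseDiff_mul_avg_pow_le (hΓ : IsVirtuallyAbelian Γ) {μ : Measure Γ}
    [IsProbabilityMeasure μ] (hμ₂ : HasFiniteSecondMoment μ) (hμ : SupportGenerates μ)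
    (hT : ∀ g, ‖T g‖ ≤ 1) :
    ∃ K : ℝ, 0 ≤ K ∧ ∀ k : ℕ, ‖noiseDiff T μ * avg T (μ.prod μ) ^ k‖ ≤ K / (k + 1) := by
  have hp : IsProbabilityMeasure (μ.map Inv.inv) :=
    Measure.isProbabilityMeasure_map Measurable.of_discrete.aemeasurable
  have hT' : ∀ g, ‖oppositeRep T g‖ ≤ 1 := fun g => hT _
  obtain ⟨K, hK, h⟩ := exists_norm_avg_noiseMeasure_pow_mul_le hΓ hμ₂.map_inv hμ.map_inv hT'
  refine ⟨K, hK, fun k => ?_⟩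
  have h1 := h 1 (by norm_num) le_rfl k
  have hT₁ : ∀ g, ‖T.comp (MonoidHom.inl Γ Γ) g‖ ≤ 1 := fun g => hT _
  have hT₂ : ∀ g, ‖T.comp (MonoidHom.inr Γ Γ) g‖ ≤ 1 := fun g => hT _
  have e1 : (oppositeRep T).comp (MonoidHom.inl Γ Γ) =
      oppositeRep (T.comp (MonoidHom.inl Γ Γ)) := by ext g; simp [oppositeRep]
  have e2 : (oppositeRep T).comp (MonoidHom.inr Γ Γ) =
      oppositeRep (T.comp (MonoidHom.inr Γ Γ)) := by ext g; simp [oppositeRep]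
  have e3 : (oppositeRep T).comp (diagHom Γ) = oppositeRep (T.comp (diagHom Γ)) := rfl
  have hH : avg (oppositeRep T) ((μ.map Inv.inv).prod (μ.map Inv.inv)) =
      MulOpposite.op (avg T (μ.prod μ)) := by
    rw [avg_prod hT', avg_prod hT, e1, e2, avg_oppositeRep, avg_oppositeRep,
      ← MulOpposite.op_mul]
    congr 1
    exact (commute_avg hT₁ (fun g => (commute_avg hT₂ (fun h => commute_inl_inr g h) μ).symm) μ).eq
  have hD : noiseDiff (oppositeRep T) (μ.map Inv.inv) = MulOpposite.op (noiseDiff T μ) := by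
    rw [noiseDiff, hH, e3, avg_oppositeRep, noiseDiff, MulOpposite.op_sub]
  rw [avg_noiseMeasure hT' _ zero_le_one le_rfl, hD, hH, sub_self, zero_smul, add_zero,
    ← MulOpposite.op_pow, ← MulOpposite.op_mul, MulOpposite.norm_op] at h1
  exact h1

end Opposite

/-! ### Telescoping over the position of the noise increment -/

section Telescoping

lemma pow_sub_pow_eq_sum {R : Type*} [Ring R] (a b : R) (n : ℕ) :
    a ^ n - b ^ n = ∑ k ∈ Finset.range n, a ^ k * (a - b) * b ^ (n - 1 - k) := by
  induction n with
  | zero => simp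
  | succ n ih =>
    have h : ∀ k ∈ Finset.range n, a ^ k * (a - b) * b ^ (n + 1 - 1 - k) =
        a ^ k * (a - b) * b ^ (n - 1 - k) * b := fun k hk => by
      rw [mul_assoc _ (b ^ _) b, ← pow_succ]
      congr 2
      have := Finset.mem_range.mp hk
      omega
    rw [Finset.sum_range_succ, Finset.sum_congr rfl h, ← Finset.sum_mul, ← ih]
    simp only [Nat.add_sub_cancel, Nat.sub_self, pow_zero, mul_one, pow_succ]
    noncomm_ring

variable {Γ : Type*} [Group Γ] [MeasurableSpace Γ] [DiscreteMeasurableSpace Γ] [Countable Γ]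
  {𝔸 : Type*} [NormedRing 𝔸] [NormedAlgebra ℝ 𝔸] [CompleteSpace 𝔸] [NormOneClass 𝔸]
  {T : Γ × Γ →* 𝔸}

/-- In each telescoping term the larger of `k` and `j` is at least `(n-1)/2`. Using the decay on
that side bounds every term by a multiple of `(1 - ρ)/(n + 1)`, and there are `n` of them. -/
lemma exists_norm_avg_pow_sub_le (hΓ : IsVirtuallyAbelian Γ) {μ : Measure Γ}
    [IsProbabilityMeasure μ] (hμ₂ : HasFiniteSecondMoment μ) (hμ : SupportGenerates μ)
    (hT : ∀ g, ‖T g‖ ≤ 1) :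
    ∃ K : ℝ, ∀ ρ : ℝ, 1 / 2 ≤ ρ → ρ ≤ 1 → ∀ n : ℕ,
      ‖avg T (noiseMeasure μ ρ) ^ n - avg T (μ.prod μ) ^ n‖ ≤ K * (1 - ρ) := by
  obtain ⟨K₁, hK₁, h₁⟩ := exists_norm_avg_noiseMeasure_pow_mul_le hΓ hμ₂ hμ hT
  obtain ⟨K₂, hK₂, h₂⟩ := exists_norm_noiseDiff_mul_avg_pow_le hΓ hμ₂ hμ hT
  refine ⟨2 * (K₁ + K₂), fun ρ hρ hρ1 n => ?_⟩
  have hπ := isProbabilityMeasure_noiseMeasure μ (by linarith : 0 ≤ ρ) hρ1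
  have h₁ := h₁ ρ hρ hρ1
  have hPH := avg_noiseMeasure hT μ (by linarith : 0 ≤ ρ) hρ1
  have hP : ‖avg T (noiseMeasure μ ρ)‖ ≤ 1 := (norm_avg_le hT _).trans (by simp)
  have hH : ‖avg T (μ.prod μ)‖ ≤ 1 := (norm_avg_le hT _).trans (by simp)
  set P := avg T (noiseMeasure μ ρ)
  set H := avg T (μ.prod μ)
  have hD : P - H = (1 - ρ) • noiseDiff T μ := by rw [hPH, add_sub_cancel_left]; rfl
  have hpow : ∀ {X : 𝔸}, ‖X‖ ≤ 1 → ∀ j : ℕ, ‖X ^ j‖ ≤ 1 := fun hX j =>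
    (norm_pow_le _ _).trans (pow_le_one₀ (norm_nonneg _) hX)
  have hterm : ∀ k ∈ Finset.range n, ‖P ^ k * (P - H) * H ^ (n - 1 - k)‖ ≤
      (1 - ρ) * (2 * (K₁ + K₂) / (n + 1)) := by
    intro k hk
    have hkn : k + (n - 1 - k) + 1 = n := by have := Finset.mem_range.mp hk; omega
    generalize n - 1 - k = j at *
    have hkn' : (n : ℝ) = k + j + 1 := by exact_mod_cast hkn.symm
    rw [hD, mul_smul_comm, smul_mul_assoc, norm_smul, Real.norm_of_nonneg (by linarith)]
    refine mul_le_mul_of_nonneg_left ?_ (by linarith)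
    have b1 : ‖P ^ k * noiseDiff T μ * H ^ j‖ ≤ K₁ / (k + 1) :=
      (norm_mul_le _ _).trans ((mul_le_of_le_one_right (norm_nonneg _) (hpow hH j)).trans (h₁ k))
    have b2 : ‖P ^ k * noiseDiff T μ * H ^ j‖ ≤ K₂ / (j + 1) := by
      rw [mul_assoc]
      exact (norm_mul_le _ _).trans
        ((mul_le_of_le_one_left (norm_nonneg _) (hpow hP k)).trans (h₂ j))
    rcases le_total (j : ℝ) k with h | h
    · refine b1.trans ?_
      rw [div_le_div_iff₀ (by positivity) (by positivity), hkn']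
      nlinarith [mul_nonneg hK₂ (Nat.cast_nonneg (α := ℝ) k), mul_nonneg hK₁ (sub_nonneg.mpr h)]
    · refine b2.trans ?_
      rw [div_le_div_iff₀ (by positivity) (by positivity), hkn']
      nlinarith [mul_nonneg hK₁ (Nat.cast_nonneg (α := ℝ) j), mul_nonneg hK₂ (sub_nonneg.mpr h)]
  rw [pow_sub_pow_eq_sum]
  refine (norm_sum_le_of_le _ hterm).trans ?_
  rw [Finset.sum_const, Finset.card_range, nsmul_eq_mul]
  have hn : (n : ℝ) * (2 * (K₁ + K₂) / (n + 1)) ≤ 2 * (K₁ + K₂) := by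
    rw [mul_div_assoc', div_le_iff₀ (by positivity)]
    nlinarith
  nlinarith [mul_le_mul_of_nonneg_left hn (sub_nonneg.mpr hρ1)]

end Telescoping

/-! ### The regular representation and total variation -/

section Translation

open scoped BoundedContinuousFunction

variable {G : Type*} [Group G] [TopologicalSpace G] [DiscreteTopology G]

/-- The Banach algebra of bounded operators on the bounded functions on `G`. -/
abbrev BddEnd (G : Type*) [TopologicalSpace G] : Type _ := (G →ᵇ ℝ) →L[ℝ] (G →ᵇ ℝ)

instance normOneClass_bddEnd : NormOneClass (BddEnd G) := by
  have : Nontrivial (G →ᵇ ℝ) := ⟨0, 1, fun h => zero_ne_one (DFunLike.congr_fun h (1 : G))⟩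
  infer_instance

/-- The right regular representation on bounded functions. -/
noncomputable def rightTranslation (G : Type*) [Group G] [TopologicalSpace G]
    [DiscreteTopology G] : G →* BddEnd G where
  toFun g := LinearMap.mkContinuous
    { toFun := fun f => f.compContinuous ⟨fun x => x * g, continuous_of_discreteTopology⟩
      map_add' := fun _ _ => rfl
      map_smul' := fun _ _ => rfl } 1 fun f => by
        rw [one_mul]
        exact (BoundedContinuousFunction.norm_le (norm_nonneg f)).mpr
          fun x => f.norm_coe_le_norm (x * g)
  map_one' := by
    ext f x
    show f (x * 1) = f x
    rw [mul_one]
  map_mul' g h := by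
    ext f x
    show f (x * (g * h)) = f (x * g * h)
    rw [mul_assoc]

@[simp]
lemma rightTranslation_apply (g : G) (f : G →ᵇ ℝ) (x : G) :
    rightTranslation G g f x = f (x * g) := rfl

lemma norm_rightTranslation_le (g : G) : ‖rightTranslation G g‖ ≤ 1 :=
  ContinuousLinearMap.opNorm_le_bound _ zero_le_one fun f => by
    rw [one_mul]
    exact (BoundedContinuousFunction.norm_le (norm_nonneg f)).mpr
      fun x => f.norm_coe_le_norm (x * g)

lemma avg_comp_rightTranslation_apply {G' : Type*} [Group G'] [MeasurableSpace G']
    [DiscreteMeasurableSpace G'] [Countable G'] (ψ : G' →* G) (ν : Measure G')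
    [IsFiniteMeasure ν] (f : G →ᵇ ℝ) :
    avg (𝔸 := BddEnd G) ((rightTranslation G).comp ψ) ν f 1 = ∫ g, f (ψ g) ∂ν := by
  have hi := integrable_rep (𝔸 := BddEnd G) (T := (rightTranslation G).comp ψ)
    (fun g => norm_rightTranslation_le _) ν
  have h1 : Integrable (fun g => rightTranslation G (ψ g) f) ν :=
    hi.apply_continuousLinearMap f
  rw [avg, ContinuousLinearMap.integral_apply hi]
  have h2 := ((BoundedContinuousFunction.evalCLM ℝ (1 : G) :
    (G →ᵇ ℝ) →L[ℝ] ℝ)).integral_comp_comm h1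
  rw [← BoundedContinuousFunction.evalCLM_apply ℝ (1 : G)]
  refine h2.symm.trans ?_
  simp

/-- The indicator function of a set as a bounded continuous function on a discrete space. -/
noncomputable def indicatorBCF (A : Set G) : G →ᵇ ℝ :=
  BoundedContinuousFunction.ofNormedAddCommGroupDiscrete (A.indicator fun _ => (1 : ℝ)) 1
    fun x => by by_cases h : x ∈ A <;> simp [h]

lemma norm_indicatorBCF_le (A : Set G) : ‖indicatorBCF A‖ ≤ 1 :=
  (BoundedContinuousFunction.norm_le zero_le_one).mpr
    fun x => by by_cases h : x ∈ A <;> simp [indicatorBCF, h]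

/-- The mass of `A` is the value at the identity of the averaged translation operator applied to the
indicator of `A`. -/
lemma tvDist_le_norm_avg_sub [MeasurableSpace G] [DiscreteMeasurableSpace G] [Countable G]
    (ν₁ ν₂ : Measure G) [IsFiniteMeasure ν₁] [IsFiniteMeasure ν₂] :
    tvDist ν₁ ν₂ ≤
      ‖avg (𝔸 := BddEnd G) (rightTranslation G) ν₁ - avg (𝔸 := BddEnd G) (rightTranslation G) ν₂‖ := by
  have : Nonempty {A : Set G // MeasurableSet A} := ⟨⟨∅, MeasurableSet.empty⟩⟩
  refine ciSup_le fun A => ?_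
  have h : ∀ ν : Measure G, IsFiniteMeasure ν →
      ν.real A.1 = avg (𝔸 := BddEnd G) (rightTranslation G) ν (indicatorBCF A.1) 1 := fun ν _ => by
    have h1 := avg_comp_rightTranslation_apply (MonoidHom.id G) ν (indicatorBCF A.1)
    rw [MonoidHom.comp_id] at h1
    rw [h1]
    exact (integral_indicator_one A.2).symm
  rw [h ν₁ inferInstance, h ν₂ inferInstance]
  set X : BddEnd G := avg (rightTranslation G) ν₁ - avg (rightTranslation G) ν₂
  show ‖X (indicatorBCF A.1) 1‖ ≤ ‖X‖
  refine (BoundedContinuousFunction.norm_coe_le_norm _ _).trans ?_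
  refine (ContinuousLinearMap.le_opNorm _ _).trans ?_
  exact mul_le_of_le_one_right (norm_nonneg _) (norm_indicatorBCF_le _)

end Translation

/-! ### The upper bound for the noise distance -/

section NearIndependence

variable {Γ : Type*} [Group Γ] [MeasurableSpace Γ] [DiscreteMeasurableSpace Γ] [Countable Γ]

lemma exists_noiseDist_le (hΓ : IsVirtuallyAbelian Γ) {μ : Measure Γ} [IsProbabilityMeasure μ]
    (hμ₂ : HasFiniteSecondMoment μ) (hμ : SupportGenerates μ) :
    ∃ K : ℝ, ∀ ρ : ℝ, 1 / 2 ≤ ρ → ρ ≤ 1 → ∀ n : ℕ, noiseDist μ ρ n ≤ K * (1 - ρ) := by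
  let _ : TopologicalSpace (Γ × Γ) := ⊥
  have _ : DiscreteTopology (Γ × Γ) := ⟨rfl⟩
  have hT : ∀ g : Γ × Γ, ‖rightTranslation (Γ × Γ) g‖ ≤ 1 := norm_rightTranslation_le
  obtain ⟨K, hK⟩ := exists_norm_avg_pow_sub_le (𝔸 := BddEnd (Γ × Γ)) hΓ hμ₂ hμ hT
  refine ⟨K, fun ρ hρ hρ1 n => ?_⟩
  have h := tvDist_le_norm_avg_sub (convPower (noiseMeasure μ ρ) n)
    ((convPower μ n).prod (convPower μ n))
  rw [avg_convPower (𝔸 := BddEnd (Γ × Γ)) hT,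
    avg_prod_convPower (𝔸 := BddEnd (Γ × Γ)) hT] at h
  exact h.trans (hK ρ hρ hρ1 n)

end NearIndependence

/-! ### Variance of additive functionals along a walk -/

section Variance

variable {G : Type*} [Group G] [MeasurableSpace G] [DiscreteMeasurableSpace G] [Countable G]

/-- Second moments of centered additive functionals along a random walk. -/
lemma memLp_and_integral_sq_convPower {ν : Measure G} [IsProbabilityMeasure ν] {z : G → ℝ}
    (hz : ∀ g h, z (g * h) = z g + z h) (hL : MemLp z 2 ν) (h0 : ∫ g, z g ∂ν = 0) (n : ℕ) :
    MemLp z 2 (convPower ν n) ∧ ∫ g, z g ∂convPower ν n = 0 ∧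
      ∫ g, z g ^ 2 ∂convPower ν n = n * ∫ g, z g ^ 2 ∂ν := by
  have hz1 : z 1 = 0 := by simpa using hz 1 1
  induction n with
  | zero =>
    have h : ∀ f : G → ℝ, ∫ g, f g ∂convPower ν 0 = f 1 := fun f => integral_dirac f 1
    have hf : IsFiniteMeasure (convPower ν 0) := inferInstance
    refine ⟨?_, by rw [h, hz1], by rw [h, hz1]; simp⟩
    refine MemLp.of_bound (C := 0) .of_discrete ?_
    show ∀ᵐ g ∂Measure.dirac (1 : G), ‖z g‖ ≤ 0
    rw [ae_dirac_eq]
    simp [hz1]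
  | succ n ih =>
    obtain ⟨ih1, ih2, ih3⟩ := ih
    have m1 : MemLp (fun p : G × G => z p.1) 2 ((convPower ν n).prod ν) :=
      ih1.comp_measurePreserving measurePreserving_fst
    have m2 : MemLp (fun p : G × G => z p.2) 2 ((convPower ν n).prod ν) :=
      hL.comp_measurePreserving measurePreserving_snd
    have hmap : ∀ f : G → ℝ, ∫ g, f g ∂convPower ν (n + 1) =
        ∫ p : G × G, f (p.1 * p.2) ∂(convPower ν n).prod ν := fun f =>
      integral_map Measurable.of_discrete.aemeasurable .of_discrete
    have i1 := m1.integrable one_le_two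
    have i2 := m2.integrable one_le_two
    refine ⟨?_, ?_, ?_⟩
    · refine (memLp_map_measure_iff .of_discrete Measurable.of_discrete.aemeasurable).mpr ?_
      refine (m1.add m2).ae_eq (ae_of_all _ fun p => ?_)
      simp [hz]
    · rw [hmap]
      simp only [hz]
      rw [integral_add i1 i2, integral_fun_fst z, integral_fun_snd z, ih2, h0]
      simp
    · rw [hmap]
      have e : ∀ p : G × G, z (p.1 * p.2) ^ 2 = z p.1 ^ 2 + z p.2 ^ 2 + 2 * (z p.1 * z p.2) :=
        fun p => by rw [hz]; ring
      have j1 := m1.integrable_sq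
      have j2 := m2.integrable_sq
      have j3 : Integrable (fun p : G × G => 2 * (z p.1 * z p.2)) ((convPower ν n).prod ν) :=
        ((ih1.integrable one_le_two).mul_prod (hL.integrable one_le_two)).const_mul 2
      have j4 : Integrable (fun p : G × G => z p.1 ^ 2 + z p.2 ^ 2) ((convPower ν n).prod ν) :=
        j1.add j2
      simp only [e]
      rw [integral_add j4 j3, integral_add j1 j2, integral_fun_fst fun g => z g ^ 2,
        integral_fun_snd fun g => z g ^ 2, integral_const_mul, integral_prod_mul, ih2, ih3]
      simp
      ring

end Variance

/-! ### Homomorphisms to the integers -/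

section Homomorphism

variable {Γ : Type*} [Group Γ]

lemma exists_abs_le_mul_wordLength {S : Set Γ} (hSf : S.Finite) (hS : Subgroup.closure S = ⊤)
    (u : Γ →* Multiplicative ℤ) :
    ∃ B : ℝ, ∀ g, |((u g).toAdd : ℝ)| ≤ B * wordLength S g := by
  obtain ⟨B, hB⟩ := (hSf.image fun s => |((u s).toAdd : ℝ)|).bddAbove
  have hword : ∀ l : List Γ, (∀ s ∈ l, s ∈ S ∨ s⁻¹ ∈ S) →
      |((u l.prod).toAdd : ℝ)| ≤ B * l.length := by
    intro l
    induction l with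
    | nil => simp
    | cons s l ih =>
      intro hl
      have h1 := ih fun x hx => hl x (by simp [hx])
      have h2 : |((u s).toAdd : ℝ)| ≤ B := by
        rcases hl s (by simp) with h | h
        · exact hB ⟨s, h, rfl⟩
        · simpa using hB ⟨s⁻¹, h, rfl⟩
      rw [List.prod_cons, map_mul, toAdd_mul, List.length_cons]
      push_cast
      refine (abs_add_le _ _).trans ?_
      linarith
  refine ⟨B, fun g => ?_⟩
  obtain ⟨l, h1, h2, rfl⟩ := exists_word hS g
  rw [← h1]
  exact hword l h2

/-- If `u` had constant sign on the atoms, in the weak sense, it would have that sign on the whole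
semigroup they generate; so both strict signs occur. -/
lemma exists_atoms_lt_of_surjective [MeasurableSpace Γ] {μ : Measure Γ} (hμ : SupportGenerates μ)
    {u : Γ →* Multiplicative ℤ} (hu : Function.Surjective u) :
    ∃ g ∈ atoms μ, ∃ h ∈ atoms μ, (u h).toAdd < (u g).toAdd := by
  have hall : ∀ p : ℤ → Prop, (∀ a b, p a → p b → p (a + b)) →
      (∀ g ∈ atoms μ, p (u g).toAdd) → ∀ k, p k := by
    intro p hp hatoms k
    obtain ⟨x, hx⟩ := hu (Multiplicative.ofAdd k)
    have hmem : x ∈ Subsemigroup.closure (atoms μ) := by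
      rw [show Subsemigroup.closure (atoms μ) = ⊤ from hμ]; trivial
    have : p (u x).toAdd := by
      clear hx
      induction hmem using Subsemigroup.closure_induction with
      | mem x hx => exact hatoms x hx
      | mul x y _ _ hx hy => rw [map_mul, toAdd_mul]; exact hp _ _ hx hy
    rwa [hx] at this
  have h1 : ∃ g ∈ atoms μ, 0 < (u g).toAdd := by
    by_contra! h
    have := hall (· ≤ 0) (fun a b ha hb => by omega) h 1
    omega
  have h2 : ∃ g ∈ atoms μ, (u g).toAdd < 0 := by
    by_contra! h
    have := hall (0 ≤ ·) (fun a b ha hb => by omega) h (-1)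
    omega
  obtain ⟨g, hg, hg'⟩ := h1
  obtain ⟨h, hh, hh'⟩ := h2
  exact ⟨g, hg, h, hh, hh'.trans hg'⟩

/-- The difference of the values of a homomorphism at two points. -/
def diffHom (u : Γ →* Multiplicative ℤ) : Γ × Γ →* Multiplicative ℤ :=
  u.comp (MonoidHom.fst Γ Γ) / u.comp (MonoidHom.snd Γ Γ)

lemma toAdd_diffHom (u : Γ →* Multiplicative ℤ) (p : Γ × Γ) :
    (diffHom u p).toAdd = (u p.1).toAdd - (u p.2).toAdd := rfl

end Homomorphism

/-! ### Concentration and anti-concentration of the difference -/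

section Concentration

variable {Γ : Type*} [Group Γ] [MeasurableSpace Γ] [DiscreteMeasurableSpace Γ] [Countable Γ]

/-- The difference vanishes on the diagonal, so its one-step mean and second moment under `π^ρ` are
`ρ` times those under `μ × μ`; the mean is zero by symmetry, and the second moments add up over the
`n` steps. -/
lemma exists_integral_sq_diffHom_eq {μ : Measure Γ} [IsProbabilityMeasure μ]
    (hμ₂ : HasFiniteSecondMoment μ) (u : Γ →* Multiplicative ℤ) :
    ∃ v : ℝ, 0 ≤ v ∧ ∀ ρ : ℝ, 0 ≤ ρ → ρ ≤ 1 → ∀ n : ℕ,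
      Integrable (fun p => ((diffHom u p).toAdd : ℝ) ^ 2) (convPower (noiseMeasure μ ρ) n) ∧
      ∫ p, ((diffHom u p).toAdd : ℝ) ^ 2 ∂convPower (noiseMeasure μ ρ) n = n * (ρ * v) := by
  obtain ⟨S, hSf, hS, hm⟩ := hμ₂
  obtain ⟨B, hB⟩ := exists_abs_le_mul_wordLength hSf hS u
  have hq := integrable_sq_wordLength hm
  set w : Γ → ℝ := fun g => ((u g).toAdd : ℝ) with hw
  have hwL : MemLp w 2 μ := by
    rw [memLp_two_iff_integrable_sq .of_discrete]
    refine (hq.const_mul (B ^ 2)).mono' .of_discrete (ae_of_all _ fun g => ?_)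
    rw [Real.norm_of_nonneg (by positivity), ← sq_abs, ← mul_pow]
    exact pow_le_pow_left₀ (abs_nonneg _) (hB g) 2
  set z : Γ × Γ → ℝ := fun p => ((diffHom u p).toAdd : ℝ) with hz
  have hzw : ∀ p, z p = w p.1 - w p.2 := fun p => by
    simp only [hz, hw, toAdd_diffHom]; push_cast; rfl
  have hzdiag : ∀ g, z (g, g) = 0 := fun g => by rw [hzw]; simp
  have m1 : MemLp (fun p : Γ × Γ => w p.1) 2 (μ.prod μ) :=
    hwL.comp_measurePreserving measurePreserving_fst
  have m2 : MemLp (fun p : Γ × Γ => w p.2) 2 (μ.prod μ) :=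
    hwL.comp_measurePreserving measurePreserving_snd
  have mz : MemLp z 2 (μ.prod μ) := (m1.sub m2).ae_eq (ae_of_all _ fun p => (hzw p).symm)
  refine ⟨∫ p, z p ^ 2 ∂μ.prod μ, integral_nonneg fun p => by positivity, ?_⟩
  intro ρ h0 h1 n
  have hπ := isProbabilityMeasure_noiseMeasure μ h0 h1
  have hnoise : ∀ f : Γ × Γ → ℝ, Integrable f (μ.prod μ) → (∀ g, f (g, g) = 0) →
      Integrable f (noiseMeasure μ ρ) ∧
        ∫ p, f p ∂noiseMeasure μ ρ = ρ * ∫ p, f p ∂μ.prod μ := by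
    intro f hf hd
    have hd' : Integrable f (μ.map fun g => (g, g)) := by
      rw [integrable_map_measure .of_discrete Measurable.of_discrete.aemeasurable]
      exact (integrable_zero _ _ _).congr (ae_of_all _ fun g => (hd g).symm)
    have a1 := hf.smul_measure (c := ENNReal.ofReal ρ) (by simp)
    have a2 := hd'.smul_measure (c := ENNReal.ofReal (1 - ρ)) (by simp)
    refine ⟨a1.add_measure a2, ?_⟩
    rw [noiseMeasure, integral_add_measure a1 a2, integral_smul_measure, integral_smul_measure,
      integral_map Measurable.of_discrete.aemeasurable .of_discrete, ENNReal.toReal_ofReal h0]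
    simp [hd]
  have hz0 : ∫ p, z p ∂noiseMeasure μ ρ = 0 := by
    rw [(hnoise z (mz.integrable one_le_two) hzdiag).2]
    simp only [hzw]
    rw [integral_sub (m1.integrable one_le_two) (m2.integrable one_le_two), integral_fun_fst w,
      integral_fun_snd w]
    simp
  have hz2 := hnoise (fun p => z p ^ 2) mz.integrable_sq fun g => by simp [hzdiag]
  have hzL : MemLp z 2 (noiseMeasure μ ρ) :=
    (memLp_two_iff_integrable_sq .of_discrete).mpr hz2.1
  have hadd : ∀ p q, z (p * q) = z p + z q := fun p q => by
    simp only [hz, map_mul, toAdd_mul]; push_cast; rfl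
  obtain ⟨b1, -, b3⟩ := memLp_and_integral_sq_convPower hadd hzL hz0 n
  exact ⟨b1.integrable_sq, by rw [b3, hz2.2]⟩

/-- Consecutive shifts differ by `(2ℓ+1) d`, more than the diameter `2ℓ` of the window, so at most
one translate meets it. -/
lemma sum_indicator_translates_le (ℓ : ℕ) {d : ℤ} (hd : 0 < d) (x : ℤ) (M : ℕ) :
    ∑ i ∈ Finset.range M, {y : ℤ | |y| ≤ ℓ}.indicator (fun _ => (1 : ℝ))
      (x + ((i * (2 * ℓ + 1) : ℕ) : ℤ) * d) ≤ 1 := by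
  classical
  have h : ∑ i ∈ Finset.range M, {y : ℤ | |y| ≤ ℓ}.indicator (fun _ => (1 : ℝ))
      (x + ((i * (2 * ℓ + 1) : ℕ) : ℤ) * d) =
      (((Finset.range M).filter fun i => |x + ((i * (2 * ℓ + 1) : ℕ) : ℤ) * d| ≤ (ℓ : ℤ)).card : ℝ)
      := by
    rw [Finset.card_filter]; push_cast; simp [Set.indicator_apply]
  rw [h]
  have h1 : ∀ i j : ℕ, |x + ((i * (2 * ℓ + 1) : ℕ) : ℤ) * d| ≤ (ℓ : ℤ) →
      |x + ((j * (2 * ℓ + 1) : ℕ) : ℤ) * d| ≤ (ℓ : ℤ) → ¬ i < j := by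
    intro i j hi hj hij
    push_cast at hi hj
    rw [abs_le] at hi hj
    have h2 : (i : ℤ) + 1 ≤ j := by exact_mod_cast hij
    have h3 : ((i : ℤ) + 1) * (2 * ℓ + 1) * d ≤ j * (2 * ℓ + 1) * d := by gcongr
    have h4 : (2 * (ℓ : ℤ) + 1) * 1 ≤ (2 * ℓ + 1) * d := by gcongr; omega
    nlinarith
  exact_mod_cast Finset.card_le_one.mpr fun i hi j hj => by
    have hi' := (Finset.mem_filter.mp hi).2
    have hj' := (Finset.mem_filter.mp hj).2
    have := h1 i j hi' hj'
    have := h1 j i hj' hi'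
    omega

/-- Anti-concentration of the difference of two independent walks. -/
lemma exists_measureReal_abs_diffHom_le {μ : Measure Γ} [IsProbabilityMeasure μ]
    (hμ : SupportGenerates μ) {u : Γ →* Multiplicative ℤ} (hu : Function.Surjective u) :
    ∃ C : ℝ, 0 ≤ C ∧ ∀ n ℓ M : ℕ, 0 < M →
      ((convPower μ n).prod (convPower μ n)).real {p | |(diffHom u p).toAdd| ≤ ℓ} ≤
        1 / M + M * ((2 * ℓ + 1) * (C / √(n + 1))) := by
  obtain ⟨g, hg, h, hh, hlt⟩ := exists_atoms_lt_of_surjective hμ hu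
  set Z := Multiplicative ℤ
  let _ : TopologicalSpace Z := ⊥
  have _ : DiscreteTopology Z := ⟨rfl⟩
  set ψ := diffHom u with hψ
  set T : Γ × Γ →* BddEnd Z := (rightTranslation Z).comp ψ with hTdef
  have hT : ∀ p, ‖T p‖ ≤ 1 := fun p => norm_rightTranslation_le _
  set t : Z := ψ (g, h) with ht
  have htd : 0 < t.toAdd := by rw [ht, hψ, toAdd_diffHom]; simpa using hlt
  have hgh : (g, g) ≠ (g, h) := fun he => by
    have : g = h := congrArg Prod.snd he
    rw [this] at hlt
    exact lt_irrefl _ hlt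
  set η := μ.prod μ with hη
  have hpos : ∀ a ∈ atoms μ, ∀ b ∈ atoms μ, 0 < η.real {(a, b)} := by
    intro a ha b hb
    rw [hη, ← Set.singleton_prod_singleton, measureReal_prod_prod]
    exact mul_pos (ENNReal.toReal_pos ha (measure_ne_top _ _))
      (ENNReal.toReal_pos hb (measure_ne_top _ _))
  set c := min (η.real {(g, g)}) (η.real {(g, h)}) with hcdef
  have hc : 0 < c := lt_min (hpos g hg g hg) (hpos g hg h hh)
  classical
  -- On the diagonal point `T (g, g) = 1`, so these two atoms supply the lazy part `c • (1 + T (g,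
  -- h))` needed for smoothing along `t`.
  obtain ⟨ν', hf, -, hmass, havg⟩ := exists_avg_eq (𝔸 := BddEnd Z) hT η hc.le
    (Q := {(g, g), (g, h)}) (by
      intro p hp
      rcases Finset.mem_insert.mp hp with rfl | hp
      · exact min_le_left _ _
      · rw [Finset.mem_singleton.mp hp]; exact min_le_right _ _)
  rw [Finset.card_pair hgh] at hmass
  have hT1 : T (g, g) = 1 := by
    have : ψ (g, g) = 1 := by
      apply Multiplicative.toAdd.injective
      rw [hψ, toAdd_diffHom]; simp
    rw [hTdef, MonoidHom.comp_apply, this, map_one]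
  rw [Finset.sum_pair hgh, hT1] at havg
  have hmass' : 2 * c ≤ 1 := by
    have : 0 ≤ ν'.real Set.univ := measureReal_nonneg
    push_cast at hmass
    linarith
  have hgrad := norm_smul_one_add_add_pow_mul_le (y := T (g, h)) (D := avg (𝔸 := BddEnd Z) T ν')
    hc hmass' (hT _) (commute_avg (𝔸 := BddEnd Z) hT (fun p => by
      rw [commute_iff_eq, ← map_mul, hTdef, MonoidHom.comp_apply, map_mul ψ, mul_comm (ψ (g, h)),
        ← map_mul ψ]
      exact map_mul T p (g, h)) ν')
    ((norm_avg_le (𝔸 := BddEnd Z) hT ν').trans (by rw [hmass]; push_cast; linarith))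
  rw [← havg] at hgrad
  refine ⟨1 / c, by positivity, fun n ℓ M hM => ?_⟩
  set ν := (convPower μ n).prod (convPower μ n) with hν
  have hνavg : avg (𝔸 := BddEnd Z) T ν = avg (𝔸 := BddEnd Z) T η ^ n :=
    avg_prod_convPower (𝔸 := BddEnd Z) hT μ n
  set δ := 1 / c / √((n : ℝ) + 1) with hδ
  have hδ0 : 0 ≤ δ := by positivity
  have hshift : ∀ j : ℕ, ‖avg (𝔸 := BddEnd Z) T ν * (1 - rightTranslation Z (t ^ j))‖ ≤ j * δ := by
    intro j
    have h1 := norm_mul_one_sub_list_prod_mul_le (𝔸 := BddEnd Z) (R := rightTranslation Z)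
      norm_rightTranslation_le (X := avg (𝔸 := BddEnd Z) T ν) (z := 1)
      (fun _ => Commute.one_right _) (F := {t}) (M := δ) (fun s hs => by
        rw [Finset.mem_singleton.mp hs, mul_one, hνavg]
        exact hgrad n) (List.replicate j t) (fun s hs => by
        rw [List.eq_of_mem_replicate hs]; simp)
    simpa using h1
  set I : Set Z := {y | |y.toAdd| ≤ (ℓ : ℤ)} with hI
  set f := indicatorBCF I with hfdef
  have hfx : ∀ x : Z, f x = I.indicator (fun _ => (1 : ℝ)) x := fun x => rfl
  have hval : ∀ j : ℕ, ((avg (𝔸 := BddEnd Z) T ν) (rightTranslation Z (t ^ j) f)) 1 =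
      ∫ p, f (ψ p * t ^ j) ∂ν := fun j => by
    rw [hTdef, avg_comp_rightTranslation_apply]
    rfl
  have hνI : ν.real {p | |(ψ p).toAdd| ≤ (ℓ : ℤ)} = ∫ p, f (ψ p) ∂ν :=
    (integral_indicator_one (s := {p | |(ψ p).toAdd| ≤ (ℓ : ℤ)}) (MeasurableSet.of_discrete)).symm
  -- Shifting the window by `t ^ j` costs at most `j * δ`. Averaging over the `M` disjoint shifts
  -- below bounds the probability by `1 / M` plus the largest such cost.
  have hcmp : ∀ j : ℕ, ν.real {p | |(ψ p).toAdd| ≤ (ℓ : ℤ)} ≤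
      ∫ p, f (ψ p * t ^ j) ∂ν + j * δ := by
    intro j
    have h0 := hval 0
    simp only [pow_zero, mul_one, map_one] at h0
    rw [hνI, ← h0, ← hval j]
    have h1 : ‖(avg (𝔸 := BddEnd Z) T ν * (1 - rightTranslation Z (t ^ j))) f 1‖ ≤ j * δ :=
      (BoundedContinuousFunction.norm_coe_le_norm _ _).trans
        ((ContinuousLinearMap.le_opNorm _ _).trans
          ((mul_le_of_le_one_right (norm_nonneg _) (norm_indicatorBCF_le _)).trans (hshift j)))
    have h2 : (avg (𝔸 := BddEnd Z) T ν * (1 - rightTranslation Z (t ^ j))) f 1 =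
        avg (𝔸 := BddEnd Z) T ν ((1 : BddEnd Z) f) 1 -
          avg (𝔸 := BddEnd Z) T ν (rightTranslation Z (t ^ j) f) 1 := by
      rw [← BoundedContinuousFunction.sub_apply, ← map_sub]
      rfl
    rw [h2, Real.norm_eq_abs] at h1
    linarith [le_abs_self (avg (𝔸 := BddEnd Z) T ν ((1 : BddEnd Z) f) 1 -
      avg (𝔸 := BddEnd Z) T ν (rightTranslation Z (t ^ j) f) 1)]
  have hint : ∀ j : ℕ, Integrable (fun p => f (ψ p * t ^ j)) ν := fun j =>
    Integrable.of_bound .of_discrete 1 (ae_of_all _ fun p =>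
      (f.norm_coe_le_norm _).trans (norm_indicatorBCF_le _))
  have hsum1 : ∑ i ∈ Finset.range M, ∫ p, f (ψ p * t ^ (i * (2 * ℓ + 1))) ∂ν ≤ 1 := by
    rw [← integral_finsetSum _ fun i _ => hint _]
    refine (integral_mono (integrable_finsetSum _ fun i _ => hint _) (integrable_const (1 : ℝ))
      fun p => ?_).trans (by simp)
    refine le_trans (le_of_eq (Finset.sum_congr rfl fun i _ => ?_))
      (sum_indicator_translates_le ℓ htd (ψ p).toAdd M)
    have hiff : ψ p * t ^ (i * (2 * ℓ + 1)) ∈ I ↔ (ψ p).toAdd +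
        ((i * (2 * ℓ + 1) : ℕ) : ℤ) * t.toAdd ∈ {y : ℤ | |y| ≤ (ℓ : ℤ)} := by
      have e : ∀ (x y : Multiplicative ℤ) (k : ℕ), (x * y ^ k).toAdd = x.toAdd + k * y.toAdd :=
        fun x y k => by rw [toAdd_mul, toAdd_pow, nsmul_eq_mul]
      rw [← e]
      rfl
    by_cases hx : ψ p * t ^ (i * (2 * ℓ + 1)) ∈ I
    · rw [hfx, Set.indicator_of_mem hx, Set.indicator_of_mem (hiff.mp hx)]
    · rw [hfx, Set.indicator_of_notMem hx, Set.indicator_of_notMem fun h' => hx (hiff.mpr h')]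
  have hsum := Finset.sum_le_sum fun i (_ : i ∈ Finset.range M) => hcmp (i * (2 * ℓ + 1))
  rw [Finset.sum_const, Finset.card_range, nsmul_eq_mul, Finset.sum_add_distrib] at hsum
  have hsum2 : ∑ i ∈ Finset.range M, ((i * (2 * ℓ + 1) : ℕ) : ℝ) * δ ≤
      M * (M * ((2 * ℓ + 1) * δ)) := by
    refine (Finset.sum_le_card_nsmul _ _ (M * ((2 * ℓ + 1) * δ)) fun i hi => ?_).trans (by simp)
    have : (i : ℝ) ≤ M := by exact_mod_cast (Finset.mem_range.mp hi).le
    push_cast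
    rw [mul_assoc]
    gcongr
  have hM' : (0 : ℝ) < M := by exact_mod_cast hM
  have hfin : (M : ℝ) * ν.real {p | |(ψ p).toAdd| ≤ (ℓ : ℤ)} ≤
      M * (1 / M + M * ((2 * ℓ + 1) * δ)) := by
    rw [mul_add, mul_one_div_cancel hM'.ne']
    linarith
  exact le_of_mul_le_mul_left hfin hM'

end Concentration

/-! ### Elementary bounds on total variation -/

section TotalVariation

variable {X : Type*} [MeasurableSpace X] {ν₁ ν₂ : Measure X} [IsProbabilityMeasure ν₁]
  [IsProbabilityMeasure ν₂]

lemma abs_measureReal_sub_le_one (A : Set X) : |ν₁.real A - ν₂.real A| ≤ 1 := by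
  have h1 : ν₁.real A ≤ 1 := measureReal_le_one
  have h2 : ν₂.real A ≤ 1 := measureReal_le_one
  have h3 : 0 ≤ ν₁.real A := measureReal_nonneg
  have h4 : 0 ≤ ν₂.real A := measureReal_nonneg
  rw [abs_le]
  constructor <;> linarith

lemma abs_measureReal_sub_le_tvDist {A : Set X} (hA : MeasurableSet A) :
    |ν₁.real A - ν₂.real A| ≤ tvDist ν₁ ν₂ :=
  le_ciSup (f := fun A : {A : Set X // MeasurableSet A} => |ν₁.real A - ν₂.real A|)
    ⟨1, by rintro _ ⟨A, rfl⟩; exact abs_measureReal_sub_le_one _⟩ ⟨A, hA⟩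

lemma tvDist_nonneg : 0 ≤ tvDist ν₁ ν₂ :=
  (abs_nonneg _).trans (abs_measureReal_sub_le_tvDist (ν₁ := ν₁) (ν₂ := ν₂) MeasurableSet.empty)

lemma tvDist_le_one : tvDist ν₁ ν₂ ≤ 1 := by
  have : Nonempty {A : Set X // MeasurableSet A} := ⟨⟨∅, MeasurableSet.empty⟩⟩
  exact ciSup_le fun A => abs_measureReal_sub_le_one _

end TotalVariation

/-! ### The two limits -/

section Limits

variable {Γ : Type*} [Group Γ] [MeasurableSpace Γ] [DiscreteMeasurableSpace Γ] [Countable Γ]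

lemma noiseDist_mem_Icc (μ : Measure Γ) [IsProbabilityMeasure μ] {ρ : ℝ} (h0 : 0 ≤ ρ)
    (h1 : ρ ≤ 1) (n : ℕ) : noiseDist μ ρ n ∈ Set.Icc (0 : ℝ) 1 := by
  have hπ := isProbabilityMeasure_noiseMeasure μ h0 h1
  exact ⟨tvDist_nonneg, tvDist_le_one⟩

lemma tendsto_limsup_noiseDist (hΓ : IsVirtuallyAbelian Γ) {μ : Measure Γ}
    [IsProbabilityMeasure μ] (hμ₂ : HasFiniteSecondMoment μ) (hμ : SupportGenerates μ) :
    Tendsto (fun ρ : ℝ => limsup (fun n : ℕ => noiseDist μ ρ n) atTop) (𝓝[<] 1) (𝓝 0) := by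
  obtain ⟨K, hK⟩ := exists_noiseDist_le hΓ hμ₂ hμ
  have hlim : Tendsto (fun ρ : ℝ => K * (1 - ρ)) (𝓝[<] 1) (𝓝 0) := by
    have h : Tendsto (fun ρ : ℝ => K * (1 - ρ)) (𝓝 1) (𝓝 (K * (1 - 1))) :=
      Continuous.tendsto (by fun_prop) 1
    rw [sub_self, mul_zero] at h
    exact h.mono_left nhdsWithin_le_nhds
  have hev : ∀ᶠ ρ : ℝ in 𝓝[<] 1, ρ ∈ Set.Ioo (1 / 2 : ℝ) 1 :=
    Ioo_mem_nhdsLT (by norm_num)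
  refine tendsto_of_tendsto_of_tendsto_of_le_of_le' tendsto_const_nhds hlim ?_ ?_
  · filter_upwards [hev] with ρ hρ
    have h := noiseDist_mem_Icc μ (by linarith [hρ.1] : 0 ≤ ρ) hρ.2.le
    exact le_limsup_of_frequently_le (Frequently.of_forall fun n => (h n).1)
      (isBoundedUnder_of ⟨1, fun n => (h n).2⟩)
  · filter_upwards [hev] with ρ hρ
    have h := noiseDist_mem_Icc μ (by linarith [hρ.1] : 0 ≤ ρ) hρ.2.le
    exact limsup_le_of_le (isBoundedUnder_of ⟨0, fun n => (h n).1⟩).isCoboundedUnder_le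
      (Eventually.of_forall fun n => hK ρ hρ.1.le hρ.2.le n)

lemma exists_le_noiseDist {μ : Measure Γ} [IsProbabilityMeasure μ]
    (hμ₂ : HasFiniteSecondMoment μ) (hμ : SupportGenerates μ) {u : Γ →* Multiplicative ℤ}
    (hu : Function.Surjective u) :
    ∃ v C : ℝ, 0 ≤ v ∧ 0 ≤ C ∧ ∀ s : ℝ, 0 < s → s ≤ 1 → ∀ n M : ℕ, 0 < n → 0 < M →
      1 - s ^ 2 * v - 1 / M - M * ((2 * s + 3 / √(n + 1)) * C) ≤ noiseDist μ (s ^ 4) n := by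
  obtain ⟨v, hv, hvar⟩ := exists_integral_sq_diffHom_eq hμ₂ u
  obtain ⟨C, hC, hconc⟩ := exists_measureReal_abs_diffHom_le hμ hu
  refine ⟨v, C, hv, hC, fun s hs hs1 n M hn hM => ?_⟩
  have hρ0 : 0 ≤ s ^ 4 := by positivity
  have hρ1 : s ^ 4 ≤ 1 := pow_le_one₀ hs.le hs1
  have hπ := isProbabilityMeasure_noiseMeasure μ hρ0 hρ1
  obtain ⟨hint, hI⟩ := hvar (s ^ 4) hρ0 hρ1 n
  have hn' : (0 : ℝ) < n := by exact_mod_cast hn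
  have hsn : 0 < s * √n := by positivity
  -- The window lies between the two scales: under `π^ρ_n` the deviation is of order `s² √n`, so
  -- Chebyshev's inequality leaves `s² v` outside, while under the product a window of size `s √n`
  -- has small mass for small `s`.
  set ℓ := ⌈s * √n⌉₊ with hℓ
  have hℓ1 : s * √n ≤ ℓ := Nat.le_ceil _
  have hℓ2 : (ℓ : ℝ) ≤ s * √n + 1 := (Nat.ceil_lt_add_one hsn.le).le
  have hℓsq : s ^ 2 * n ≤ (ℓ : ℝ) ^ 2 := by
    have h := pow_le_pow_left₀ hsn.le hℓ1 2
    rwa [mul_pow, Real.sq_sqrt hn'.le] at h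
  set π := convPower (noiseMeasure μ (s ^ 4)) n with hπdef
  set η := (convPower μ n).prod (convPower μ n) with hη
  set A : Set (Γ × Γ) := {p | |(diffHom u p).toAdd| ≤ (ℓ : ℤ)} with hA
  have hAc : π.real Aᶜ ≤ s ^ 2 * v := by
    have h1 := mul_meas_ge_le_integral_of_nonneg (μ := π)
      (f := fun p => ((diffHom u p).toAdd : ℝ) ^ 2) (ae_of_all _ fun p => by positivity) hint
      (s ^ 2 * n)
    rw [hI] at h1
    have h2 : π.real Aᶜ ≤ π.real {p | s ^ 2 * n ≤ ((diffHom u p).toAdd : ℝ) ^ 2} := by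
      refine measureReal_mono (fun p hp => ?_)
      have h3 : (ℓ : ℤ) < |(diffHom u p).toAdd| := not_le.mp hp
      have h4 : (ℓ : ℝ) ≤ |((diffHom u p).toAdd : ℝ)| := by exact_mod_cast h3.le
      have h5 := pow_le_pow_left₀ (Nat.cast_nonneg _) h4 2
      rw [sq_abs] at h5
      exact hℓsq.trans h5
    have h3 : s ^ 2 * n * π.real Aᶜ ≤ s ^ 2 * n * (s ^ 2 * v) := by
      refine (mul_le_mul_of_nonneg_left h2 (by positivity)).trans (h1.trans (le_of_eq ?_))
      ring
    exact le_of_mul_le_mul_left h3 (by positivity)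
  have hπA : 1 - s ^ 2 * v ≤ π.real A := by
    have h := probReal_add_probReal_compl (μ := π) (MeasurableSet.of_discrete (s := A))
    linarith
  have hηA : η.real A ≤ 1 / M + M * ((2 * s + 3 / √(n + 1)) * C) := by
    refine (hconc n ℓ M hM).trans ?_
    have hsq : 0 < √((n : ℝ) + 1) := by positivity
    have h1 : (2 * (ℓ : ℝ) + 1) / √(n + 1) ≤ 2 * s + 3 / √(n + 1) := by
      have h2 : √(n : ℝ) ≤ √(n + 1) := Real.sqrt_le_sqrt (by linarith)
      have h3 : (2 * s + 3 / √((n : ℝ) + 1)) = (2 * s * √(n + 1) + 3) / √(n + 1) := by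
        field_simp
      rw [h3]
      refine div_le_div_of_nonneg_right ?_ hsq.le
      linarith [mul_le_mul_of_nonneg_left h2 hs.le]
    have h4 : (2 * (ℓ : ℝ) + 1) * (C / √(n + 1)) = (2 * (ℓ : ℝ) + 1) / √(n + 1) * C := by ring
    rw [h4]
    gcongr
  have h := abs_measureReal_sub_le_tvDist (ν₁ := π) (ν₂ := η) (MeasurableSet.of_discrete (s := A))
  have h' := (le_abs_self _).trans h
  show _ ≤ tvDist π η
  linarith

lemma tendsto_liminf_noiseDist {μ : Measure Γ} [IsProbabilityMeasure μ]
    (hμ₂ : HasFiniteSecondMoment μ) (hμ : SupportGenerates μ) {u : Γ →* Multiplicative ℤ}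
    (hu : Function.Surjective u) :
    Tendsto (fun ρ : ℝ => liminf (fun n : ℕ => noiseDist μ ρ n) atTop) (𝓝[>] 0) (𝓝 1) := by
  obtain ⟨v, C, hv, hC, hlow⟩ := exists_le_noiseDist hμ₂ hμ hu
  have hev : ∀ᶠ ρ : ℝ in 𝓝[>] 0, ρ ∈ Set.Ioo (0 : ℝ) 1 := Ioo_mem_nhdsGT (by norm_num)
  rw [Metric.tendsto_nhds]
  intro ε hε
  -- The number `M` of translates is fixed first; then `ρ` is taken small in terms of `M`, and
  -- finally `n` large.
  obtain ⟨M, hM⟩ := exists_nat_gt (1 / (ε / 5))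
  have hM0 : (0 : ℝ) < M := lt_trans (by positivity) hM
  have hM1 : 1 / (M : ℝ) < ε / 5 := by
    rw [div_lt_iff₀ hM0]
    rwa [div_lt_iff₀ (by positivity), mul_comm] at hM
  have hs : Tendsto (fun ρ : ℝ => √√ρ ^ 2 * v + M * (2 * √√ρ * C)) (𝓝[>] 0) (𝓝 0) := by
    have h : Tendsto (fun ρ : ℝ => √√ρ ^ 2 * v + M * (2 * √√ρ * C)) (𝓝 0)
        (𝓝 (√√0 ^ 2 * v + M * (2 * √√0 * C))) := Continuous.tendsto (by fun_prop) 0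
    simp only [Real.sqrt_zero] at h
    simpa using h.mono_left nhdsWithin_le_nhds
  have hn : Tendsto (fun n : ℕ => M * (3 / √((n : ℝ) + 1) * C)) atTop (𝓝 0) := by
    have h1 : Tendsto (fun n : ℕ => √((n : ℝ) + 1)) atTop atTop :=
      Real.tendsto_sqrt_atTop.comp (tendsto_natCast_atTop_atTop.atTop_add tendsto_const_nhds)
    have h2 := ((h1.const_div_atTop 3).mul_const C).const_mul (M : ℝ)
    simpa using h2
  filter_upwards [hev, hs.eventually_lt_const (by positivity : 0 < ε / 5)] with ρ hρ hρs
  have h := noiseDist_mem_Icc μ hρ.1.le hρ.2.le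
  have hbdd : IsBoundedUnder (· ≤ ·) atTop fun n : ℕ => noiseDist μ ρ n :=
    isBoundedUnder_of ⟨1, fun n => (h n).2⟩
  have hbdd' : IsBoundedUnder (· ≥ ·) atTop fun n : ℕ => noiseDist μ ρ n :=
    isBoundedUnder_of ⟨0, fun n => (h n).1⟩
  have hle : liminf (fun n : ℕ => noiseDist μ ρ n) atTop ≤ 1 :=
    liminf_le_of_frequently_le (Frequently.of_forall fun n => (h n).2) hbdd'
  have hs4 : √√ρ ^ 4 = ρ := by
    rw [show 4 = 2 * 2 from rfl, pow_mul, Real.sq_sqrt (Real.sqrt_nonneg _),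
      Real.sq_sqrt hρ.1.le]
  have hge : 1 - 3 * (ε / 5) ≤ liminf (fun n : ℕ => noiseDist μ ρ n) atTop := by
    refine le_liminf_of_le hbdd.isCoboundedUnder_ge ?_
    filter_upwards [eventually_gt_atTop 0,
      hn.eventually_lt_const (by positivity : 0 < ε / 5)] with n hn0 hnε
    have h1 := hlow √√ρ (Real.sqrt_pos.mpr (Real.sqrt_pos.mpr hρ.1))
      (Real.sqrt_le_one.mpr (Real.sqrt_le_one.mpr hρ.2.le)) n M hn0 (by exact_mod_cast hM0)
    rw [hs4] at h1
    have h2 : (M : ℝ) * ((2 * √√ρ + 3 / √(n + 1)) * C) =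
      M * (2 * √√ρ * C) + M * (3 / √(n + 1) * C) := by ring
    linarith
  rw [Real.dist_eq, abs_lt]
  constructor <;> linarith

lemma not_isNoiseSensitive_of_tendsto {μ : Measure Γ}
    (h : Tendsto (fun ρ : ℝ => liminf (fun n : ℕ => noiseDist μ ρ n) atTop) (𝓝[>] 0) (𝓝 1)) :
    ¬ IsNoiseSensitive μ := by
  intro hs
  have hev : ∀ᶠ ρ : ℝ in 𝓝[>] 0, ρ ∈ Set.Ioo (0 : ℝ) 1 := Ioo_mem_nhdsGT (by norm_num)
  obtain ⟨ρ, hρ, hpos⟩ := (hev.and (h.eventually_const_lt one_pos)).exists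
  rw [(hs ρ ⟨hρ.1, hρ.2.le⟩).liminf_eq] at hpos
  exact lt_irrefl _ hpos

end Limits

theorem theorem2 {Γ : Type*} [Group Γ] [Group.FG Γ] [MeasurableSpace Γ]
    [DiscreteMeasurableSpace Γ] (hΓ : IsVirtuallyAbelian Γ)
    (μ : Measure Γ) [IsProbabilityMeasure μ]
    (hμ₂ : HasFiniteSecondMoment μ) (hμ : SupportGenerates μ) :
    Tendsto (fun ρ : ℝ => limsup (fun n : ℕ => noiseDist μ ρ n) atTop) (𝓝[<] 1) (𝓝 0) ∧
    ((∃ φ : Γ →* Multiplicative ℤ, Function.Surjective φ) →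
      Tendsto (fun ρ : ℝ => liminf (fun n : ℕ => noiseDist μ ρ n) atTop) (𝓝[>] 0) (𝓝 1) ∧
      ¬ IsNoiseSensitive μ) := by
  obtain ⟨S, hS⟩ := Group.fg_def.mp ‹Group.FG Γ›
  have : Countable Γ := countable_of_closure_eq_top S.finite_toSet hS
  refine ⟨tendsto_limsup_noiseDist hΓ hμ₂ hμ, fun ⟨u, hu⟩ => ?_⟩
  have h := tendsto_liminf_noiseDist hμ₂ hμ hu
  exact ⟨h, not_isNoiseSensitive_of_tendsto h⟩
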